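/- Let $\lambda>1$ be a natural number and consider on $\mathbb{R}^3$ the rattleback system $$\dot x=\lambda xz,\qquad \dot y=-yz,\qquad \dot z=y^2-\lambda x^2,$$ with energy-Casimir map $\mathcal{EC}:\mathbb{R}^3\to\mathbb{R}^2$, $\mathcal{EC}(x,y,z)=\left(xy^\lambda,\tfrac12(x^2+y^2+z^2)\right)$, and fibers $\mathcal F_{(h,c)}=\mathcal{EC}^{-1}(\{(h,c)\})$. Let $\mathcal E^{s,\star}=\{(M,\pm M\sqrt\lambda,0): M\in\mathbb{R},\ M\neq0\}$ and $\mathcal E^{u}=\{(0,0,M): M\in\mathbb{R},\ M\ne0\}$, and define the strata $$\Sigma^{p,\pm}=\left\{(h,c): h^2<\lambda^\lambda\left(\tfrac{2}{\lambda+1}\right)^{\lambda+1}c^{\lambda+1},\ \pm h>0,\ c>0\right\},\qquad \Sigma^{s,\pm,\star}=\mathcal{EC}(\mathcal E^{s,\star})\cap\{(h,c):\pm h>0,\ c>0\},$$ $$\Sigma^{u}=\mathcal{EC}(\mathcal E^{u}),\qquad \Sigma^{s,0}=\{\mathcal{EC}(0,0,0)\}=\{(0,0)\}.$$ A periodic orbit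 is the orbit of a nonconstant periodic solution; stable means Lyapunov stable in $\mathbb{R}^3$, and unstable means not Lyapunov stable. A heteroclinic orbit from an equilibrium $a$ to an equilibrium $b\neq a$ is the orbit of a solution defined for all times that tends to $a$ as $t\to-\infty$ and to $b$ as $t\to+\infty$. A heteroclinic cycle is the union of finitely many (at least two) distinct, cyclically ordered equilibria and of heteroclinic orbits, one from each equilibrium to the next. Then $\operatorname{Im}(\mathcal{EC})=S^+\cup S^-$ with $S^{\pm}=\Sigma^{p,\pm}\cup\Sigma^{s,\pm,\star}\cup\Sigma^{u}\cup\Sigma^{s,0}$, and the fibers of $\mathcal{EC}$ are as follows. 1. If $(h,c)\in\Sigma^{p,+}\cup\Sigma^{p,-}$, then $\mathcal F_{(h,c)}$ is homeomorphic to $S^1\amalg S^1$, and it is the union of two disjoint periodic orbits, each homeomorphic to $S^1$. 2. If $(h,c)\in\Sigma^{s,+,\star}\cup\Sigma^{s,-,\star}$, then $\mathcal F_{(h,c)}$ consists of exactly two points, both of which are stable equilibrium states. 3. If $(h,c)\in\Sigma^{u}$, then $h=0$, $c=r^2/2$ for some $r>0$, and $\mathcal F_{(h,c)}$ is the intersection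 of the sphere $x^2+y^2+z^2=r^2$ with $\{xy=0\}$, i.e. the union of the four closed great semicircles in $\{xy=0\}$ joining $(0,0,-r)$ and $(0,0,r)$. These two points are unstable equilibrium states. The two open semicircles in the plane $x=0$ are heteroclinic orbits from $(0,0,-r)$ to $(0,0,r)$, and the two open semicircles in the plane $y=0$ are heteroclinic orbits from $(0,0,r)$ to $(0,0,-r)$. Each semicircle in $x=0$ together with each semicircle in $y=0$ (endpoints included) forms a heteroclinic cycle, and $\mathcal F_{(h,c)}$ is the union of these four cycles. 4. If $(h,c)\in\Sigma^{s,0}$, then $(h,c)=(0,0)$ and $\mathcal F_{(h,c)}=\{(0,0,0)\}$, which is a stable equilibrium state. -/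

import Mathlib

open Set Filter Topology

noncomputable section

namespace Rattleback

/-- The phase space `ℝ³`; the coordinates `(x, y, z)` are `p 0`, `p 1`, `p 2`. -/
abbrev R3 := EuclideanSpace ℝ (Fin 3)

/-! ### Notions from the theory of autonomous systems `u' = F u` on `ℝ³` -/

/-- `γ` is a solution, defined for all times, of the autonomous system `u' = F u`. -/
def IsSolution (F : R3 → R3) (γ : ℝ → R3) : Prop :=
  IsIntegralCurve γ (fun _ => F)

/-- `γ` is a solution on `[0, ∞)` of the autonomous system `u' = F u` with initial value `p`. -/
def IsForwardSolution (F : R3 → R3) (γ : ℝ → R3) (p : R3) : Prop :=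
  IsIntegralCurveOn γ (fun _ => F) (Ici 0) ∧ γ 0 = p

def IsEquilibrium (F : R3 → R3) (e : R3) : Prop := F e = 0

/-- Lyapunov stability of `e`: for every `ε > 0` there is `δ > 0` such that each initial value
within `δ` of `e` has a solution on `[0, ∞)`, and every such solution stays within `ε` of `e`. -/
def LyapunovStable (F : R3 → R3) (e : R3) : Prop :=
  ∀ ε > 0, ∃ δ > 0, ∀ p : R3, dist p e < δ →
    (∃ γ, IsForwardSolution F γ p) ∧
      ∀ γ, IsForwardSolution F γ p → ∀ t, 0 ≤ t → dist (γ t) e < ε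

def IsStableEquilibrium (F : R3 → R3) (e : R3) : Prop :=
  IsEquilibrium F e ∧ LyapunovStable F e

def IsUnstableEquilibrium (F : R3 → R3) (e : R3) : Prop :=
  IsEquilibrium F e ∧ ¬ LyapunovStable F e

/-- `O` is the orbit of a nonconstant periodic solution. -/
def IsPeriodicOrbit (F : R3 → R3) (O : Set R3) : Prop :=
  ∃ (γ : ℝ → R3) (T : ℝ), 0 < T ∧ IsSolution F γ ∧ Function.Periodic γ T ∧
    (∃ s t, γ s ≠ γ t) ∧ range γ = O

/-- `O` is a heteroclinic orbit running from the equilibrium `a` to the equilibrium `b ≠ a`. -/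
def IsHeteroclinicOrbit (F : R3 → R3) (a b : R3) (O : Set R3) : Prop :=
  IsEquilibrium F a ∧ IsEquilibrium F b ∧ a ≠ b ∧
    ∃ γ : ℝ → R3, IsSolution F γ ∧ Tendsto γ atBot (𝓝 a) ∧ Tendsto γ atTop (𝓝 b) ∧ range γ = O

/-- `Γ` is a heteroclinic cycle: it consists of finitely many (at least two) distinct equilibria
`e 0, e 1, …`, cyclically ordered, and for each `i` of a heteroclinic orbit from `e i` to
`e (i + 1)`. The addition in `Fin (n + 2)` is modulo `n + 2`. -/
def IsHeteroclinicCycle (F : R3 → R3) (Γ : Set R3) : Prop :=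
  ∃ (n : ℕ) (e : Fin (n + 2) → R3) (O : Fin (n + 2) → Set R3), Function.Injective e ∧
    (∀ i, IsHeteroclinicOrbit F (e i) (e (i + 1)) (O i)) ∧ Γ = ⋃ i, insert (e i) (O i)

/-! ### The rattleback system and its energy-Casimir map -/

/-- The right-hand side `(lam x z, - y z, y² - lam x²)` of the rattleback system. -/
def field (lam : ℕ) (p : R3) : R3 :=
  !₂[(lam : ℝ) * p 0 * p 2, -(p 1 * p 2), p 1 ^ 2 - (lam : ℝ) * p 0 ^ 2]

/-- The energy-Casimir map `(H, C) = (x y ^ lam, (x² + y² + z²) / 2)`. -/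
def EC (lam : ℕ) (p : R3) : ℝ × ℝ :=
  (p 0 * p 1 ^ lam, (p 0 ^ 2 + p 1 ^ 2 + p 2 ^ 2) / 2)

/-- The fiber of the energy-Casimir map over `q = (h, c)`. -/
def fiber (lam : ℕ) (q : ℝ × ℝ) : Set R3 := EC lam ⁻¹' {q}

/-! ### The families of equilibria and the strata -/

/-- The equilibria `(M, ± M √lam, 0)` with `M ≠ 0`. -/
def equilibriaSStar (lam : ℕ) : Set R3 :=
  {p | ∃ M : ℝ, M ≠ 0 ∧ (p = !₂[M, -(M * √(lam : ℝ)), 0] ∨ p = !₂[M, M * √(lam : ℝ), 0])}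

/-- The equilibrium `(0, 0, M)`. -/
def e3 (M : ℝ) : R3 := !₂[0, 0, M]

/-- The equilibria `(0, 0, M)` with `M ≠ 0`. -/
def equilibriaU : Set R3 := {p | ∃ M : ℝ, M ≠ 0 ∧ p = e3 M}

def sigmaSPlus (lam : ℕ) : Set (ℝ × ℝ) :=
  EC lam '' equilibriaSStar lam ∩ {q | 0 < q.1 ∧ 0 < q.2}

def sigmaSMinus (lam : ℕ) : Set (ℝ × ℝ) :=
  EC lam '' equilibriaSStar lam ∩ {q | q.1 < 0 ∧ 0 < q.2}

def sigmaSZero (lam : ℕ) : Set (ℝ × ℝ) := EC lam '' {0}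

def sigmaU (lam : ℕ) : Set (ℝ × ℝ) := EC lam '' equilibriaU

def sigmaPPlus (lam : ℕ) : Set (ℝ × ℝ) :=
  {q | q.1 ^ 2 < (lam : ℝ) ^ lam * (2 / ((lam : ℝ) + 1)) ^ (lam + 1) * q.2 ^ (lam + 1) ∧
    0 < q.1 ∧ 0 < q.2}

def sigmaPMinus (lam : ℕ) : Set (ℝ × ℝ) :=
  {q | q.1 ^ 2 < (lam : ℝ) ^ lam * (2 / ((lam : ℝ) + 1)) ^ (lam + 1) * q.2 ^ (lam + 1) ∧
    q.1 < 0 ∧ 0 < q.2}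

/-! ### Great semicircles with endpoints `(0, 0, ± r)` on the sphere of radius `r` -/

/-- The open great semicircle in the plane `x = 0` on which `y` has the sign `s`. -/
def semicircleX (r : ℝ) (s : ℤˣ) : Set R3 :=
  {p | p 0 = 0 ∧ 0 < ((s : ℤ) : ℝ) * p 1 ∧ p 1 ^ 2 + p 2 ^ 2 = r ^ 2}

/-- The open great semicircle in the plane `y = 0` on which `x` has the sign `s`. -/
def semicircleY (r : ℝ) (s : ℤˣ) : Set R3 :=
  {p | p 1 = 0 ∧ 0 < ((s : ℤ) : ℝ) * p 0 ∧ p 0 ^ 2 + p 2 ^ 2 = r ^ 2}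

/-- The closed great semicircle in `x = 0` with sign `s` together with the closed great
semicircle in `y = 0` with sign `t`; they share their two endpoints. -/
def semicirclePair (r : ℝ) (s t : ℤˣ) : Set R3 :=
  {e3 r, e3 (-r)} ∪ semicircleX r s ∪ semicircleY r t

end Rattleback

end

/-! Both components of `EC` are first integrals. The energy confines solutions to spheres, so
solutions are global and unique, and the geometry of the fibers decides the dynamics.

Weighted AM-GM applied to `x²` and `y²` (`mul_mul_pow_le`, `casimir_sq_le`) bounds `h²` by the
expression defining the principal strata, with equality only where `z = 0` and `y² = lam x²`. This
gives one inclusion for the image and shows that fibers over the critical strata are two mirror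
points. An equilibrium isolated in its fiber is stable, since the distance between values of `EC`
acts as a Lyapunov function.

For `h = 0` the system restricted to `x = 0` or `y = 0` is solved by `1 / cosh` and `tanh`. A
heteroclinic orbit starts arbitrarily near its source and leaves it, so both poles are unstable.

For `h ≠ 0` the variable `y` keeps its sign and `x = h / y ^ lam`. With `Y = y²` the energy reads
`potential lam h Y + z² = 2c`, and the potential is strictly convex. Below its minimum value the
fiber is empty, at it there are two points, and above it each sign of `y` gives a closed curve
between two turning points. The main dynamical step is `exists_upper_turning_time`: a solution from
the lower turning point reaches the upper one in finite time. Time reversal then closes the orbit,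
and `exists_circle_param` identifies it with a circle. -/

noncomputable section

namespace Rattleback

/-! ### Global solutions of autonomous systems -/

section ODE

variable {E : Type*} [NormedAddCommGroup E] [NormedSpace ℝ E]

/-- Two solutions on the symmetric intervals `(-a, a)` and `(-b, b)` of an autonomous system with
Lipschitz right-hand side and with the same value at `0` agree where both are defined. -/
theorem eq_of_hasDerivAt_of_lipschitz {G : E → E} {K : NNReal} (hG : LipschitzWith K G)
    {α β : ℝ → E} {a b : ℝ}
    (hα : ∀ t ∈ Ioo (-a) a, HasDerivAt α (G (α t)) t)
    (hβ : ∀ t ∈ Ioo (-b) b, HasDerivAt β (G (β t)) t) (h0 : α 0 = β 0) {t : ℝ}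
    (ha : |t| < a) (hb : |t| < b) : α t = β t := by
  have hm : |t| < min a b := lt_min ha hb
  have hpos : 0 < min a b := (abs_nonneg t).trans_lt hm
  refine ODE_solution_unique_of_mem_Ioo (v := fun _ => G) (s := fun _ => univ) (t₀ := 0)
    (a := -min a b) (b := min a b) (K := K) (fun s _ => hG.lipschitzOnWith)
    ⟨by linarith, hpos⟩ (fun s hs => ⟨hα s ?_, mem_univ _⟩) (fun s hs => ⟨hβ s ?_, mem_univ _⟩)
    h0 (abs_lt.1 hm)
  · exact ⟨(neg_le_neg (min_le_left a b)).trans_lt hs.1, hs.2.trans_le (min_le_left a b)⟩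
  · exact ⟨(neg_le_neg (min_le_right a b)).trans_lt hs.1, hs.2.trans_le (min_le_right a b)⟩

/-- A bounded Lipschitz vector field is complete. -/
theorem exists_isIntegralCurve_of_lipschitz_of_bounded [CompleteSpace E] {G : E → E}
    {K L : NNReal} (hG : LipschitzWith K G) (hL : ∀ x, ‖G x‖ ≤ L) (p : E) :
    ∃ γ : ℝ → E, IsIntegralCurve γ (fun _ => G) ∧ γ 0 = p := by
  -- Speed at most `L` keeps the solution in the ball of radius `L * (n + 1)` up to time `n + 1`, so
  -- Picard-Lindelöf applies on intervals exhausting `ℝ`. Taking `n + 1` keeps `0` interior even for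
  -- `n = 0`.
  have hloc : ∀ n : ℕ, ∃ α : ℝ → E, α 0 = p ∧
      ∀ t ∈ Ioo (-((n : ℝ) + 1)) (n + 1), HasDerivAt α (G (α t)) t := by
    intro n
    have hn : (0 : ℝ) ≤ n := n.cast_nonneg
    have hPL : IsPicardLindelof (fun _ => G) (tmin := -((n : ℝ) + 1)) (tmax := n + 1)
        ⟨0, by linarith, by linarith⟩ p (L * (n + 1)) 0 L K :=
      { lipschitzOnWith := fun _ _ => hG.lipschitzOnWith
        continuousOn := fun _ _ => continuousOn_const
        norm_le := fun _ _ x _ => hL x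
        mul_max_le := by simp }
    obtain ⟨α, h0, hα⟩ := hPL.exists_eq_forall_mem_Icc_hasDerivWithinAt₀
    exact ⟨α, h0, fun t ht => (hα t (Ioo_subset_Icc_self ht)).hasDerivAt
      (Icc_mem_nhds ht.1 ht.2)⟩
  choose α h0 hα using hloc
  have key : ∀ (m n : ℕ) (t : ℝ), |t| < m + 1 → |t| < n + 1 → α m t = α n t := fun m n t hm hn =>
    eq_of_hasDerivAt_of_lipschitz hG (hα m) (hα n) ((h0 m).trans (h0 n).symm) hm hn
  have hceil : ∀ t : ℝ, |t| < (⌈|t|⌉₊ : ℝ) + 1 := fun t => (Nat.le_ceil _).trans_lt (lt_add_one _)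
  refine ⟨fun t => α ⌈|t|⌉₊ t, fun t => ?_, h0 _⟩
  refine (hα ⌈|t|⌉₊ t (abs_lt.1 (hceil t))).congr_of_eventuallyEq ?_
  filter_upwards [Ioo_mem_nhds (abs_lt.1 (hceil t)).1 (abs_lt.1 (hceil t)).2] with s hs
  exact key _ _ s (hceil s) (abs_lt.2 hs)

end ODE

/-- A `C¹` field is Lipschitz on a closed ball, which is compact and convex; boundedness places both
solutions in one such ball. -/
theorem isSolution_eq_of_bounded {F : R3 → R3} (hF : ContDiff ℝ 1 F) {γ γ' : ℝ → R3} {R t₀ : ℝ}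
    (hγ : IsSolution F γ) (hγ' : IsSolution F γ') (hb : ∀ t, ‖γ t‖ ≤ R) (hb' : ∀ t, ‖γ' t‖ ≤ R)
    (h : γ t₀ = γ' t₀) : γ = γ' := by
  obtain ⟨K, hK⟩ := hF.contDiffOn.exists_lipschitzOnWith one_ne_zero
    (convex_closedBall (0 : R3) R) (isCompact_closedBall 0 R)
  exact ODE_solution_unique_univ (v := fun _ => F) (s := fun _ => Metric.closedBall 0 R)
    (fun _ => hK) (fun t => ⟨hγ t, by simpa using hb t⟩) (fun t => ⟨hγ' t, by simpa using hb' t⟩) h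

/-- A `C¹` vector field tangent to all spheres centred at the origin is complete. -/
theorem exists_isSolution_of_inner_eq_zero {F : R3 → R3} (hF : ContDiff ℝ 1 F)
    (hinner : ∀ p, inner ℝ p (F p) = 0) (p : R3) : ∃ γ, IsSolution F γ ∧ γ 0 = p := by
  -- The cut-off field is still tangent to spheres, so its solution keeps norm `‖p‖` and stays where
  -- the bump equals `1`.
  let χ : ContDiffBump (0 : R3) := ⟨‖p‖ + 1, ‖p‖ + 2, by positivity, by linarith⟩
  have hχ : ContDiff ℝ 1 (fun x => χ x) := χ.contDiff
  have hcs : HasCompactSupport (fun x => χ x • F x) := χ.hasCompactSupport.smul_right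
  have hG : ContDiff ℝ 1 (fun x => χ x • F x) := hχ.smul hF
  obtain ⟨K, hK⟩ := hG.lipschitzWith_of_hasCompactSupport hcs one_ne_zero
  obtain ⟨L, hL⟩ := hcs.exists_bound_of_continuous hG.continuous
  obtain ⟨γ, hγ, h0⟩ := exists_isIntegralCurve_of_lipschitz_of_bounded hK
    (L := L.toNNReal) (fun x => (hL x).trans (Real.le_coe_toNNReal L)) p
  have hder : ∀ t, HasDerivAt (fun s => ‖γ s‖ ^ 2) 0 t := fun t => by
    have := (hγ t).norm_sq
    rwa [inner_smul_right, hinner, mul_zero, mul_zero] at this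
  have hnorm : ∀ t, ‖γ t‖ = ‖p‖ := fun t => by
    have := is_const_of_deriv_eq_zero (fun s => (hder s).differentiableAt)
      (fun s => (hder s).deriv) t 0
    rw [h0] at this
    exact (sq_eq_sq₀ (norm_nonneg _) (norm_nonneg _)).1 this
  refine ⟨γ, fun t => ?_, h0⟩
  have h1 : χ (γ t) = 1 := χ.one_of_mem_closedBall (by simp [χ, hnorm t])
  simpa [h1] using hγ t

/-! ### Periodic curves and circles -/

/-- A nonconstant periodic curve whose coincidences are periods is a homeomorphic image of the
circle. -/
theorem exists_circle_param {X : Type*} [TopologicalSpace X] [T2Space X] {γ : ℝ → X}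
    (hc : Continuous γ) (hne : ∃ s t, γ s ≠ γ t) {T : ℝ} (hT : 0 < T) (hper : Function.Periodic γ T)
    (hinj : ∀ s t, γ s = γ t → Function.Periodic γ (s - t)) :
    ∃ f : Circle → X, Continuous f ∧ Function.Injective f ∧ range f = range γ := by
  let P : AddSubgroup ℝ :=
    { carrier := {a | Function.Periodic γ a}
      add_mem' := fun ha hb => ha.add_period hb
      zero_mem' := fun x => by simp
      neg_mem' := fun ha => ha.neg }
  have hPT : T ∈ P := hper
  -- A subgroup of `ℝ` is dense or cyclic, and a dense group of periods would make `γ` constant.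
  have hnd : ¬ Dense (P : Set ℝ) := by
    rintro hd
    obtain ⟨s, t, hst⟩ := hne
    have h0 : ∀ a ∈ (P : Set ℝ), γ a = γ 0 := fun a ha => by simpa using ha 0
    have : ∀ a, γ a = γ 0 := fun a =>
      congrFun (hc.ext_on hd continuous_const h0) a
    exact hst ((this s).trans (this t).symm)
  obtain ⟨a, ha⟩ := P.dense_or_cyclic.resolve_left hnd
  have haP : Function.Periodic γ a := show a ∈ P from ha ▸ AddSubgroup.mem_closure_singleton_self a
  -- The generator may be negative; only `a ≠ 0` is needed for the circle.
  have ha0 : a ≠ 0 := by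
    rintro rfl
    rw [ha, AddSubgroup.mem_closure_singleton] at hPT
    obtain ⟨n, hn⟩ := hPT
    simp at hn
    exact hT.ne hn
  let g : AddCircle a → X := haP.lift
  have hg : ∀ t : ℝ, g t = γ t := fun t => haP.lift_coe t
  have hgc : Continuous g := continuous_coinduced_dom.2 hc
  refine ⟨g ∘ (AddCircle.homeomorphCircle ha0).symm, hgc.comp (Homeomorph.continuous _), ?_, ?_⟩
  · refine Function.Injective.comp ?_ (Homeomorph.injective _)
    rintro ⟨s⟩ ⟨t⟩ hst
    have hst' : γ s = γ t := hst
    have hmem : s - t ∈ P := hinj s t hst'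
    rw [ha, AddSubgroup.mem_closure_singleton] at hmem
    obtain ⟨n, hn⟩ := hmem
    exact sub_eq_zero.1 ((AddCircle.coe_sub a s t).symm.trans
      ((AddCircle.coe_eq_zero_iff a).2 ⟨n, hn⟩))
  · rw [(AddCircle.homeomorphCircle ha0).symm.surjective.range_comp]
    ext x
    constructor
    · rintro ⟨⟨t⟩, rfl⟩
      exact ⟨t, rfl⟩
    · rintro ⟨t, rfl⟩
      exact ⟨t, rfl⟩

theorem nonempty_range_homeomorph {X Y : Type*} [TopologicalSpace X] [TopologicalSpace Y]
    [CompactSpace X] [T2Space Y] {f : X → Y} (hf : Continuous f) (hinj : Function.Injective f)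
    {S : Set Y} (hS : range f = S) : Nonempty (S ≃ₜ X) := by
  subst hS
  exact ⟨(hf.isClosedEmbedding hinj).isEmbedding.toHomeomorph.symm⟩

/-! ### The rattleback field: global solutions, first integrals, symmetries -/

@[simp] theorem field_zero (lam : ℕ) (p : R3) : field lam p 0 = lam * p 0 * p 2 := rfl
@[simp] theorem field_one (lam : ℕ) (p : R3) : field lam p 1 = -(p 1 * p 2) := rfl
@[simp] theorem field_two (lam : ℕ) (p : R3) :
    field lam p 2 = p 1 ^ 2 - lam * p 0 ^ 2 := rfl

theorem ext3 {p q : R3} (h0 : p 0 = q 0) (h1 : p 1 = q 1) (h2 : p 2 = q 2) : p = q := by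
  ext i
  fin_cases i <;> assumption

theorem norm_sq3 (p : R3) : ‖p‖ ^ 2 = p 0 ^ 2 + p 1 ^ 2 + p 2 ^ 2 := by
  simp [EuclideanSpace.norm_sq_eq, Fin.sum_univ_three]

theorem contDiff_field (lam : ℕ) : ContDiff ℝ 1 (field lam) := by
  rw [contDiff_euclidean]
  have h : ∀ i : Fin 3, ContDiff ℝ 1 (fun p : R3 => p i) := fun i =>
    (EuclideanSpace.proj (𝕜 := ℝ) i : R3 →L[ℝ] ℝ).contDiff
  intro i
  fin_cases i
  · exact (contDiff_const.mul (h 0)).mul (h 2)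
  · exact ((h 1).mul (h 2)).neg
  · exact ((h 1).pow 2).sub (contDiff_const.mul ((h 0).pow 2))

theorem inner_field (lam : ℕ) (p : R3) : inner ℝ p (field lam p) = 0 := by
  simp [PiLp.inner_apply, Fin.sum_univ_three]
  ring

theorem continuous_EC (lam : ℕ) : Continuous (EC lam) := by
  unfold EC
  fun_prop

theorem hasDerivWithinAt_iff_coord {γ : ℝ → R3} {v : R3} {s : Set ℝ} {t : ℝ} :
    HasDerivWithinAt γ v s t ↔ ∀ i, HasDerivWithinAt (fun t => γ t i) (v i) s t := by
  simp only [hasDerivWithinAt_iff_hasFDerivWithinAt]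
  rw [hasFDerivWithinAt_euclidean]
  refine forall_congr' fun i => ?_
  have : (PiLp.proj 2 (fun _ : Fin 3 => ℝ) i) ∘L (ContinuousLinearMap.toSpanSingleton ℝ v) =
      ContinuousLinearMap.toSpanSingleton ℝ (v i) := by
    ext
    simp
  rw [← this]

theorem hasDerivAt_iff_coord {γ : ℝ → R3} {v : R3} {t : ℝ} :
    HasDerivAt γ v t ↔ ∀ i, HasDerivAt (fun t => γ t i) (v i) t := by
  simp only [← hasDerivWithinAt_univ]
  exact hasDerivWithinAt_iff_coord

theorem exists_isSolution (lam : ℕ) (p : R3) : ∃ γ, IsSolution (field lam) γ ∧ γ 0 = p :=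
  exists_isSolution_of_inner_eq_zero (contDiff_field lam) (inner_field lam) p

theorem hasDerivWithinAt_coord {lam : ℕ} {γ : ℝ → R3} {s : Set ℝ}
    (hγ : IsIntegralCurveOn γ (fun _ => field lam) s) {t : ℝ} (ht : t ∈ s) (i : Fin 3) :
    HasDerivWithinAt (fun t => γ t i) (field lam (γ t) i) s t :=
  (hasDerivWithinAt_iff_coord.1 (hγ t ht)) i

theorem hasDerivAt_coord {lam : ℕ} {γ : ℝ → R3} (hγ : IsSolution (field lam) γ) (t : ℝ)
    (i : Fin 3) : HasDerivAt (fun t => γ t i) (field lam (γ t) i) t :=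
  (hasDerivAt_iff_coord.1 (hγ t)) i

theorem isSolution_of_coord {lam : ℕ} {γ : ℝ → R3}
    (h0 : ∀ t, HasDerivAt (fun t => γ t 0) (lam * γ t 0 * γ t 2) t)
    (h1 : ∀ t, HasDerivAt (fun t => γ t 1) (-(γ t 1 * γ t 2)) t)
    (h2 : ∀ t, HasDerivAt (fun t => γ t 2) (γ t 1 ^ 2 - lam * γ t 0 ^ 2) t) :
    IsSolution (field lam) γ := by
  refine fun t => hasDerivAt_iff_coord.2 fun i => ?_
  fin_cases i
  · exact h0 t
  · exact h1 t
  · exact h2 t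

/-- The energy and the Casimir function are first integrals. -/
theorem EC_eq_of_isIntegralCurveOn {lam : ℕ} (hlam : lam ≠ 0) {γ : ℝ → R3} {s : Set ℝ}
    (hs : Convex ℝ s) (hγ : IsIntegralCurveOn γ (fun _ => field lam) s) {a b : ℝ} (ha : a ∈ s)
    (hb : b ∈ s) : EC lam (γ a) = EC lam (γ b) := by
  have hd := fun t (ht : t ∈ s) => hasDerivWithinAt_coord hγ ht
  have key : ∀ f : ℝ → ℝ, (∀ t ∈ s, HasDerivWithinAt f 0 s t) → f a = f b := by
    intro f hf
    have := hs.norm_image_sub_le_of_norm_hasDerivWithin_le (C := 0) hf (by simp) hb ha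
    simpa [sub_eq_zero] using this
  refine Prod.ext (key (fun t => γ t 0 * γ t 1 ^ lam) fun t ht => ?_)
    (key (fun t => (γ t 0 ^ 2 + γ t 1 ^ 2 + γ t 2 ^ 2) / 2) fun t ht => ?_)
  · refine ((hd t ht 0).mul ((hd t ht 1).pow lam)).congr_deriv ?_
    -- This turns the exponent `lam - 1` from the power rule into `n`, so that `ring` can compare
    -- the terms.
    obtain ⟨n, rfl⟩ := Nat.exists_eq_succ_of_ne_zero hlam
    simp only [field_zero, field_one, Nat.succ_eq_add_one, Nat.add_sub_cancel, Pi.pow_apply]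
    ring
  · refine (((((hd t ht 0).pow 2).add ((hd t ht 1).pow 2)).add
      ((hd t ht 2).pow 2)).div_const 2).congr_deriv ?_
    simp only [field_zero, field_one, field_two]
    ring

theorem EC_eq_of_isSolution {lam : ℕ} (hlam : lam ≠ 0) {γ : ℝ → R3}
    (hγ : IsSolution (field lam) γ) (a b : ℝ) : EC lam (γ a) = EC lam (γ b) :=
  EC_eq_of_isIntegralCurveOn hlam convex_univ (hγ.isIntegralCurveOn univ) (mem_univ a) (mem_univ b)

theorem norm_le_of_mem_fiber {lam : ℕ} {q : ℝ × ℝ} {p : R3} (hp : p ∈ fiber lam q) :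
    ‖p‖ ≤ √(2 * q.2) := by
  have h2 : (p 0 ^ 2 + p 1 ^ 2 + p 2 ^ 2) / 2 = q.2 := congrArg Prod.snd hp
  refine Real.le_sqrt_of_sq_le ?_
  rw [norm_sq3]
  linarith

theorem isSolution_eq {lam : ℕ} (hlam : lam ≠ 0) {γ γ' : ℝ → R3} (hγ : IsSolution (field lam) γ)
    (hγ' : IsSolution (field lam) γ') {t₀ : ℝ} (h : γ t₀ = γ' t₀) : γ = γ' := by
  refine isSolution_eq_of_bounded (contDiff_field lam) hγ hγ' (R := √(2 * (EC lam (γ t₀)).2))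
    (fun t => ?_) (fun t => ?_) h
  · exact norm_le_of_mem_fiber (lam := lam) (EC_eq_of_isSolution hlam hγ t t₀)
  · exact norm_le_of_mem_fiber (lam := lam) (h ▸ EC_eq_of_isSolution hlam hγ' t t₀)

/-- Every coincidence on a solution curve is a period. -/
theorem periodic_of_eq {lam : ℕ} (hlam : lam ≠ 0) {γ : ℝ → R3} (hγ : IsSolution (field lam) γ)
    {s t : ℝ} (h : γ s = γ t) : Function.Periodic γ (s - t) := by
  have hsol : IsSolution (field lam) (γ ∘ (· + (s - t))) := hγ.comp_add (s - t)
  have := isSolution_eq hlam hsol hγ (t₀ := t) (by simpa using h)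
  exact fun x => congrFun this x

/-- The time-reversing symmetry `(x, y, z, t) ↦ (x, y, -z, -t)`. -/
theorem isSolution_reverse {lam : ℕ} {γ : ℝ → R3} (hγ : IsSolution (field lam) γ) (a : ℝ) :
    IsSolution (field lam) (fun t => !₂[γ (a - t) 0, γ (a - t) 1, -γ (a - t) 2]) := by
  have hd : ∀ t i, HasDerivAt (fun t => γ (a - t) i) (-(field lam (γ (a - t)) i)) t := by
    intro t i
    exact ((hasDerivAt_coord hγ (a - t) i).comp t ((hasDerivAt_id t).const_sub a)).congr_deriv
      (by ring)
  refine isSolution_of_coord (fun t => ?_) (fun t => ?_) (fun t => ?_)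
  · exact (hd t 0).congr_deriv (show -(lam * γ (a - t) 0 * γ (a - t) 2) =
      lam * γ (a - t) 0 * -γ (a - t) 2 by ring)
  · exact (hd t 1).congr_deriv (show - -(γ (a - t) 1 * γ (a - t) 2) =
      -(γ (a - t) 1 * -γ (a - t) 2) by ring)
  · exact (hd t 2).neg.congr_deriv (neg_neg _)

/-! ### Stability criteria -/

/-- An equilibrium which is isolated in its energy-Casimir fiber is Lyapunov stable. -/
theorem isStableEquilibrium_of_isolated {lam : ℕ} (hlam : lam ≠ 0) {e : R3}
    (he : field lam e = 0) {ε₀ : ℝ} (hε₀ : 0 < ε₀)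
    (hiso : ∀ p, EC lam p = EC lam e → dist p e < ε₀ → p = e) :
    IsStableEquilibrium (field lam) e := by
  refine ⟨he, fun ε hε => ?_⟩
  obtain ⟨ρ, hρ, hρε⟩ := exists_between (lt_min hε hε₀)
  have hρε' := hρε.trans_le (min_le_left _ _)
  have hρε₀ := hρε.trans_le (min_le_right _ _)
  have hpos : ∀ p ∈ Metric.sphere e ρ, 0 < dist (EC lam p) (EC lam e) := by
    intro p hp
    refine dist_pos.2 fun h => ?_
    rw [Metric.mem_sphere] at hp
    rw [hiso p h (hp ▸ hρε₀), dist_self] at hp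
    exact hρ.ne hp
  obtain ⟨m, hm, hmin⟩ := (isCompact_sphere e ρ).exists_forall_le'
    ((continuous_EC lam).dist continuous_const).continuousOn hpos
  obtain ⟨δ, hδ, hcont⟩ := Metric.continuousAt_iff.1 (continuous_EC lam).continuousAt m hm
  refine ⟨min δ ρ, lt_min hδ hρ, fun p hp => ⟨?_, fun γ hγ t ht => ?_⟩⟩
  · obtain ⟨γ, hγ, h0⟩ := exists_isSolution lam p
    exact ⟨γ, hγ.isIntegralCurveOn _, h0⟩
  -- A solution leaving the `ε`-ball crosses the sphere of radius `ρ`. There `EC` differs from `EC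
  -- lam e` by at least `m`, while along the solution this difference keeps its initial value, which
  -- is below `m`.
  · by_contra! hcon
    have hc : ContinuousOn (fun s => dist (γ s) e) (Icc 0 t) :=
      (continuous_id.dist continuous_const).comp_continuousOn
        (hγ.1.continuousOn.mono Icc_subset_Ici_self)
    obtain ⟨s, hs, hse⟩ := intermediate_value_Icc ht hc
      (show ρ ∈ Icc (dist (γ 0) e) (dist (γ t) e) from
        ⟨by rw [hγ.2]; exact (hp.trans_le (min_le_right _ _)).le, hρε'.le.trans hcon⟩)
    have h1 := hmin (γ s) hse
    rw [EC_eq_of_isIntegralCurveOn hlam (convex_Ici 0) hγ.1 hs.1 self_mem_Ici, hγ.2] at h1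
    exact absurd (hcont (hp.trans_le (min_le_left _ _))) (not_lt.2 h1)

/-- The source of a heteroclinic orbit is unstable. -/
theorem IsHeteroclinicOrbit.isUnstableEquilibrium {F : R3 → R3} {a b : R3} {O : Set R3}
    (h : IsHeteroclinicOrbit F a b O) : IsUnstableEquilibrium F a := by
  obtain ⟨ha, -, hab, γ, hγ, hbot, htop, -⟩ := h
  refine ⟨ha, fun hst => ?_⟩
  have hd : 0 < dist a b / 2 := half_pos (dist_pos.2 hab)
  obtain ⟨δ, hδ, hδ'⟩ := hst _ hd
  obtain ⟨s, hs⟩ := (hbot.eventually (Metric.ball_mem_nhds a hδ)).exists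
  have hfwd : IsForwardSolution F (γ ∘ (· + s)) (γ s) :=
    ⟨IsIntegralCurve.isIntegralCurveOn (IsIntegralCurve.comp_add hγ s) _, by simp⟩
  have hstay := (hδ' (γ s) hs).2 _ hfwd
  obtain ⟨t, ht, hts⟩ := ((htop.eventually (Metric.ball_mem_nhds b hd)).and
    (eventually_ge_atTop s)).exists
  have h1 := hstay (t - s) (by linarith)
  simp only [Function.comp_apply, sub_add_cancel] at h1
  have h2 := dist_triangle_left a b (γ t)
  have ht' : dist (γ t) b < dist a b / 2 := ht
  linarith

/-! ### Hyperbolic profiles -/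

theorem tanh_sq_add_inv_cosh_sq (t : ℝ) : (Real.cosh t)⁻¹ ^ 2 + Real.tanh t ^ 2 = 1 := by
  have := Real.cosh_sq t
  have h := (Real.cosh_pos t).ne'
  rw [Real.tanh_eq_sinh_div_cosh]
  field_simp
  linarith

/-- This form lets the limits of `1 / cosh` be read off from those of `tanh`. -/
theorem inv_cosh_eq_sqrt (t : ℝ) : (Real.cosh t)⁻¹ = √(1 - Real.tanh t ^ 2) := by
  rw [← tanh_sq_add_inv_cosh_sq t, add_sub_cancel_right,
    Real.sqrt_sq (inv_pos.2 (Real.cosh_pos t)).le]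

theorem hasDerivAt_tanh (t : ℝ) : HasDerivAt Real.tanh ((Real.cosh t)⁻¹ ^ 2) t := by
  have h := (Real.cosh_pos t).ne'
  have := (Real.hasDerivAt_sinh t).div (Real.hasDerivAt_cosh t) h
  have heq : Real.sinh / Real.cosh = Real.tanh := by
    ext x
    exact (Real.tanh_eq_sinh_div_cosh x).symm
  rw [heq] at this
  refine this.congr_deriv ?_
  have := Real.cosh_sq t
  field_simp
  linarith

theorem hasDerivAt_inv_cosh (t : ℝ) :
    HasDerivAt (fun t => (Real.cosh t)⁻¹) (-((Real.cosh t)⁻¹ * Real.tanh t)) t := by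
  have h := (Real.cosh_pos t).ne'
  refine ((Real.hasDerivAt_cosh t).inv h).congr_deriv ?_
  rw [Real.tanh_eq_sinh_div_cosh]
  field_simp

theorem range_tanh : range Real.tanh = Ioo (-1) 1 := by
  rw [← image_univ, Real.tanh_bijOn.image_eq]

theorem strictMono_tanh : StrictMono Real.tanh :=
  strictMono_of_hasDerivAt_pos hasDerivAt_tanh fun t => pow_pos (inv_pos.2 (Real.cosh_pos t)) 2

theorem tendsto_tanh_atTop : Tendsto Real.tanh atTop (𝓝 1) :=
  tendsto_atTop_isLUB strictMono_tanh.monotone (range_tanh ▸ isLUB_Ioo (by norm_num))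

theorem tendsto_tanh_atBot : Tendsto Real.tanh atBot (𝓝 (-1)) :=
  tendsto_atBot_isGLB strictMono_tanh.monotone (range_tanh ▸ isGLB_Ioo (by norm_num))

theorem tendsto_inv_cosh {l : Filter ℝ} {a : ℝ} (ha : a ^ 2 = 1)
    (h : Tendsto Real.tanh l (𝓝 a)) : Tendsto (fun t => (Real.cosh t)⁻¹) l (𝓝 0) := by
  have : Tendsto (fun t => √(1 - Real.tanh t ^ 2)) l (𝓝 √(1 - a ^ 2)) :=
    (Real.continuous_sqrt.tendsto _).comp ((h.pow 2).const_sub 1)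
  rw [ha, sub_self, Real.sqrt_zero] at this
  simpa only [inv_cosh_eq_sqrt] using this

/-- The profile `(σ r / cosh t, r tanh t)` covers an open semicircle. -/
theorem exists_cosh_tanh {r σ a b : ℝ} (hr : 0 < r) (hσ : σ ^ 2 = 1) (ha : 0 < σ * a)
    (hab : a ^ 2 + b ^ 2 = r ^ 2) : ∃ t, σ * r * (Real.cosh t)⁻¹ = a ∧ r * Real.tanh t = b := by
  have ha2 : 0 < a ^ 2 := by
    have : a ≠ 0 := by
      rintro rfl
      simp at ha
    positivity
  have hb : b / r ∈ Ioo (-1) 1 := by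
    refine abs_lt.1 ?_
    rw [abs_div, abs_of_pos hr, div_lt_one hr]
    exact abs_lt_of_sq_lt_sq (by linarith) hr.le
  rw [← range_tanh] at hb
  obtain ⟨t, ht⟩ := hb
  have hb' : r * Real.tanh t = b := by
    rw [ht]
    field_simp
  refine ⟨t, ?_, hb'⟩
  have h1 : r * (Real.cosh t)⁻¹ = σ * a := by
    refine (sq_eq_sq₀ (mul_pos hr (inv_pos.2 (Real.cosh_pos t))).le ha.le).1 ?_
    have := tanh_sq_add_inv_cosh_sq t
    rw [mul_pow, mul_pow, hσ, one_mul, eq_sub_of_add_eq this, eq_sub_of_add_eq hab, ← hb']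
    ring
  rw [mul_assoc, h1, ← mul_assoc, ← sq, hσ, one_mul]

theorem cosh_tanh_mem {r σ : ℝ} (hr : 0 < r) (hσ : σ ^ 2 = 1) (t : ℝ) :
    0 < σ * (σ * r * (Real.cosh t)⁻¹) ∧
      (σ * r * (Real.cosh t)⁻¹) ^ 2 + (r * Real.tanh t) ^ 2 = r ^ 2 := by
  have hpos := mul_pos hr (inv_pos.2 (Real.cosh_pos t))
  constructor
  · rwa [mul_assoc, ← mul_assoc, ← sq, hσ, one_mul]
  · have := tanh_sq_add_inv_cosh_sq t
    calc _ = σ ^ 2 * r ^ 2 * (Real.cosh t)⁻¹ ^ 2 + r ^ 2 * Real.tanh t ^ 2 := by ring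
      _ = r ^ 2 * ((Real.cosh t)⁻¹ ^ 2 + Real.tanh t ^ 2) := by rw [hσ]; ring
      _ = r ^ 2 := by rw [this, mul_one]

/-! ### Heteroclinic orbits and cycles -/

theorem isEquilibrium_e3 (lam : ℕ) (M : ℝ) : IsEquilibrium (field lam) (e3 M) :=
  ext3 (by simp [e3]) (by simp [e3]) (by simp [e3])

theorem e3_injective : Function.Injective e3 := fun a b h => by
  simpa [e3] using congrArg (fun p : R3 => p 2) h

theorem tendsto_R3 {l : Filter ℝ} {f g h : ℝ → ℝ} {a b c : ℝ} (hf : Tendsto f l (𝓝 a))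
    (hg : Tendsto g l (𝓝 b)) (hh : Tendsto h l (𝓝 c)) :
    Tendsto (fun t => (!₂[f t, g t, h t] : R3)) l (𝓝 !₂[a, b, c]) := by
  refine ((PiLp.continuous_toLp 2 (fun _ : Fin 3 => ℝ)).tendsto _).comp (tendsto_pi_nhds.2 ?_)
  intro i
  fin_cases i
  · exact hf
  · exact hg
  · exact hh

theorem sign_sq (s : ℤˣ) : ((s : ℤ) : ℝ) ^ 2 = 1 := by
  rcases Int.units_eq_one_or s with rfl | rfl <;> norm_num

theorem isHeteroclinicOrbit_semicircleX (lam : ℕ) {r : ℝ} (hr : 0 < r) (s : ℤˣ) :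
    IsHeteroclinicOrbit (field lam) (e3 (-r)) (e3 r) (semicircleX r s) := by
  have hlin : ∀ t : ℝ, HasDerivAt (fun t => r * t) r t := fun t => by
    simpa using (hasDerivAt_id t).const_mul r
  have hcosh : ∀ t : ℝ, HasDerivAt (fun t => ((s : ℤ) : ℝ) * r * (Real.cosh (r * t))⁻¹)
      (((s : ℤ) : ℝ) * r * (-((Real.cosh (r * t))⁻¹ * Real.tanh (r * t)) * r)) t := fun t =>
    ((hasDerivAt_inv_cosh (r * t)).comp t (hlin t)).const_mul _
  have htanh : ∀ t : ℝ, HasDerivAt (fun t => r * Real.tanh (r * t))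
      (r * ((Real.cosh (r * t))⁻¹ ^ 2 * r)) t := fun t =>
    ((hasDerivAt_tanh (r * t)).comp t (hlin t)).const_mul _
  have hbot : Tendsto (fun t => r * t) atBot atBot := tendsto_id.const_mul_atBot hr
  have htop : Tendsto (fun t => r * t) atTop atTop := tendsto_id.const_mul_atTop hr
  refine ⟨isEquilibrium_e3 _ _, isEquilibrium_e3 _ _, fun h => ?_,
    fun t => !₂[0, ((s : ℤ) : ℝ) * r * (Real.cosh (r * t))⁻¹, r * Real.tanh (r * t)],
    isSolution_of_coord (fun t => ?_) (fun t => ?_) (fun t => ?_), ?_, ?_, ?_⟩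
  · linarith [e3_injective h]
  · exact (hasDerivAt_const t (0 : ℝ)).congr_deriv (by simp)
  · refine (hcosh t).congr_deriv ?_
    simp
    ring
  · refine (htanh t).congr_deriv ?_
    simp only [Matrix.cons_val_zero, Matrix.cons_val_one]
    simp [mul_pow, sign_sq]
    ring
  · refine tendsto_R3 tendsto_const_nhds ?_ ?_
    · simpa using ((tendsto_inv_cosh (by norm_num) tendsto_tanh_atBot).comp hbot).const_mul
        (((s : ℤ) : ℝ) * r)
    · simpa using (tendsto_tanh_atBot.comp hbot).const_mul r
  · refine tendsto_R3 tendsto_const_nhds ?_ ?_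
    · simpa using ((tendsto_inv_cosh (by norm_num) tendsto_tanh_atTop).comp htop).const_mul
        (((s : ℤ) : ℝ) * r)
    · simpa using (tendsto_tanh_atTop.comp htop).const_mul r
  · ext p
    constructor
    · rintro ⟨t, rfl⟩
      exact ⟨rfl, (cosh_tanh_mem hr (sign_sq s) (r * t)).1,
        (cosh_tanh_mem hr (sign_sq s) (r * t)).2⟩
    · rintro ⟨h0, h1, h2⟩
      obtain ⟨t, ht1, ht2⟩ := exists_cosh_tanh hr (sign_sq s) h1 h2
      refine ⟨t / r, ext3 h0.symm ?_ ?_⟩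
      · simpa [mul_div_cancel₀ t hr.ne'] using ht1
      · simpa [mul_div_cancel₀ t hr.ne'] using ht2

theorem isHeteroclinicOrbit_semicircleY {lam : ℕ} (hlam : lam ≠ 0) {r : ℝ} (hr : 0 < r)
    (s : ℤˣ) : IsHeteroclinicOrbit (field lam) (e3 r) (e3 (-r)) (semicircleY r s) := by
  have hk : 0 < (lam : ℝ) * r := by positivity
  have hlin : ∀ t : ℝ, HasDerivAt (fun t => lam * r * t) (lam * r) t := fun t => by
    simpa using (hasDerivAt_id t).const_mul (lam * r)
  have hcosh : ∀ t : ℝ, HasDerivAt (fun t => ((s : ℤ) : ℝ) * r * (Real.cosh (lam * r * t))⁻¹)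
      (((s : ℤ) : ℝ) * r *
        (-((Real.cosh (lam * r * t))⁻¹ * Real.tanh (lam * r * t)) * (lam * r))) t := fun t =>
    ((hasDerivAt_inv_cosh (lam * r * t)).comp t (hlin t)).const_mul _
  have htanh : ∀ t : ℝ, HasDerivAt (fun t => -(r * Real.tanh (lam * r * t)))
      (-(r * ((Real.cosh (lam * r * t))⁻¹ ^ 2 * (lam * r)))) t := fun t =>
    (((hasDerivAt_tanh (lam * r * t)).comp t (hlin t)).const_mul _).neg
  have hbot : Tendsto (fun t => lam * r * t) atBot atBot := tendsto_id.const_mul_atBot hk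
  have htop : Tendsto (fun t => lam * r * t) atTop atTop := tendsto_id.const_mul_atTop hk
  refine ⟨isEquilibrium_e3 _ _, isEquilibrium_e3 _ _, fun h => ?_,
    fun t => !₂[((s : ℤ) : ℝ) * r * (Real.cosh (lam * r * t))⁻¹, 0,
      -(r * Real.tanh (lam * r * t))],
    isSolution_of_coord (fun t => ?_) (fun t => ?_) (fun t => ?_), ?_, ?_, ?_⟩
  · linarith [e3_injective h]
  · refine (hcosh t).congr_deriv ?_
    simp
    ring
  · exact (hasDerivAt_const t (0 : ℝ)).congr_deriv (by simp)
  · refine (htanh t).congr_deriv ?_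
    simp [mul_pow, sign_sq]
    ring
  · refine tendsto_R3 ?_ tendsto_const_nhds ?_
    · simpa using ((tendsto_inv_cosh (by norm_num) tendsto_tanh_atBot).comp hbot).const_mul
        (((s : ℤ) : ℝ) * r)
    · simpa using ((tendsto_tanh_atBot.comp hbot).const_mul r).neg
  · refine tendsto_R3 ?_ tendsto_const_nhds ?_
    · simpa using ((tendsto_inv_cosh (by norm_num) tendsto_tanh_atTop).comp htop).const_mul
        (((s : ℤ) : ℝ) * r)
    · simpa using ((tendsto_tanh_atTop.comp htop).const_mul r).neg
  · ext p
    constructor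
    · rintro ⟨t, rfl⟩
      have := cosh_tanh_mem hr (sign_sq s) (lam * r * t)
      exact ⟨rfl, this.1, by rw [← this.2, ← neg_sq (r * _)]; rfl⟩
    · rintro ⟨h0, h1, h2⟩
      obtain ⟨t, ht1, ht2⟩ := exists_cosh_tanh hr (sign_sq s) h1 ((neg_sq (p 2)).symm ▸ h2)
      refine ⟨t / (lam * r), ext3 ?_ h0.symm ?_⟩
      · simpa [mul_div_cancel₀ t hk.ne'] using ht1
      · simpa [mul_div_cancel₀ t hk.ne', neg_eq_iff_eq_neg] using ht2

theorem isHeteroclinicCycle_semicirclePair {lam : ℕ} (hlam : lam ≠ 0) {r : ℝ} (hr : 0 < r)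
    (s t : ℤˣ) : IsHeteroclinicCycle (field lam) (semicirclePair r s t) := by
  -- With `n = 0` the indices lie in `Fin 2`, so `i + 1` swaps the two poles.
  refine ⟨0, ![e3 (-r), e3 r], ![semicircleX r s, semicircleY r t], ?_, ?_, ?_⟩
  · have : e3 (-r) ≠ e3 r := fun h => by linarith [e3_injective h]
    intro i j
    fin_cases i <;> fin_cases j <;> simp [this, this.symm]
  · intro i
    fin_cases i
    · exact isHeteroclinicOrbit_semicircleX lam hr s
    · exact isHeteroclinicOrbit_semicircleY hlam hr t
  · ext p
    simp [semicirclePair, Fin.exists_fin_two]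
    tauto

/-! ### The fibers over the axis `h = 0` -/

theorem mem_fiber {lam : ℕ} {h c : ℝ} {p : R3} :
    p ∈ fiber lam (h, c) ↔ p 0 * p 1 ^ lam = h ∧ (p 0 ^ 2 + p 1 ^ 2 + p 2 ^ 2) / 2 = c := by
  simp [fiber, EC, Prod.ext_iff]

theorem mul_pow_eq_zero {lam : ℕ} (hlam : lam ≠ 0) (p : R3) :
    p 0 * p 1 ^ lam = 0 ↔ p 0 * p 1 = 0 := by
  simp [hlam]

theorem fiber_zero_eq_inter_sphere {lam : ℕ} (hlam : lam ≠ 0) {r : ℝ} (hr : 0 < r) :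
    fiber lam (0, r ^ 2 / 2) = {p | p 0 * p 1 = 0} ∩ Metric.sphere 0 r := by
  ext p
  have h : p ∈ Metric.sphere (0 : R3) r ↔ p 0 ^ 2 + p 1 ^ 2 + p 2 ^ 2 = r ^ 2 := by
    rw [mem_sphere_zero_iff_norm, ← norm_sq3, sq_eq_sq₀ (norm_nonneg _) hr.le]
  rw [mem_fiber, mul_pow_eq_zero hlam, mem_inter_iff, h, mem_ofPred_eq,
    div_left_inj' (two_ne_zero' ℝ)]

theorem exists_sign_mul_pos {a : ℝ} (ha : a ≠ 0) : ∃ s : ℤˣ, 0 < ((s : ℤ) : ℝ) * a := by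
  rcases ha.lt_or_gt with h | h
  · exact ⟨-1, by simpa using h⟩
  · exact ⟨1, by simpa using h⟩

theorem inter_sphere_eq_iUnion {r : ℝ} (hr : 0 < r) :
    {p : R3 | p 0 * p 1 = 0} ∩ Metric.sphere 0 r = ⋃ (s : ℤˣ) (t : ℤˣ), semicirclePair r s t := by
  ext p
  have h : p ∈ Metric.sphere (0 : R3) r ↔ p 0 ^ 2 + p 1 ^ 2 + p 2 ^ 2 = r ^ 2 := by
    rw [mem_sphere_zero_iff_norm, ← norm_sq3, sq_eq_sq₀ (norm_nonneg _) hr.le]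
  simp only [mem_inter_iff, h, mem_ofPred_eq, mem_iUnion]
  constructor
  · rintro ⟨h01, h2⟩
    by_cases h0 : p 0 = 0
    · by_cases h1 : p 1 = 0
      · have : p 2 = r ∨ p 2 = -r := by
          rw [← sq_eq_sq_iff_eq_or_eq_neg, ← h2, h0, h1]
          ring
        -- The poles belong to every pair, so the signs are arbitrary.
        refine ⟨1, 1, Or.inl (Or.inl ?_)⟩
        rcases this with h | h
        · exact Or.inl (ext3 h0 h1 h)
        · exact Or.inr (ext3 h0 h1 h)
      · obtain ⟨s, hs⟩ := exists_sign_mul_pos h1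
        exact ⟨s, 1, Or.inl (Or.inr ⟨h0, hs, by rw [← h2, h0]; ring⟩)⟩
    · have h1 : p 1 = 0 := (mul_eq_zero.1 h01).resolve_left h0
      obtain ⟨s, hs⟩ := exists_sign_mul_pos h0
      exact ⟨1, s, Or.inr ⟨h1, hs, by rw [← h2, h1]; ring⟩⟩
  · rintro ⟨s, t, ((rfl | rfl) | ⟨h0, -, h⟩) | ⟨h1, -, h⟩⟩
    · simp [e3]
    · simp [e3]
    · exact ⟨by simp [h0], by rw [← h, h0]; ring⟩
    · exact ⟨by simp [h1], by rw [← h, h1]; ring⟩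

theorem eq_of_mem_sigmaU {lam : ℕ} {q : ℝ × ℝ} (hq : q ∈ sigmaU lam) :
    ∃ r : ℝ, 0 < r ∧ q = (0, r ^ 2 / 2) := by
  obtain ⟨_, ⟨M, hM, rfl⟩, rfl⟩ := hq
  exact ⟨|M|, abs_pos.2 hM, by simp [EC, e3]⟩

theorem mem_sigmaU {lam : ℕ} {c : ℝ} (hc : 0 < c) : (0, c) ∈ sigmaU lam := by
  refine ⟨e3 √(2 * c), ⟨√(2 * c), (Real.sqrt_pos.2 (by linarith)).ne', rfl⟩, ?_⟩
  have : √(2 * c) ^ 2 = 2 * c := Real.sq_sqrt (by linarith)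
  exact Prod.ext (by simp [EC, e3]) (show ((0 : ℝ) ^ 2 + 0 ^ 2 + √(2 * c) ^ 2) / 2 = c by
    rw [this]; ring)

theorem sigmaSZero_eq (lam : ℕ) : sigmaSZero lam = {(0, 0)} := by
  simp [sigmaSZero, EC]

theorem fiber_zero_zero {lam : ℕ} : fiber lam (0, 0) = {0} := by
  ext p
  rw [mem_fiber, mem_singleton_iff]
  constructor
  · rintro ⟨-, h⟩
    have : ‖p‖ ^ 2 = 0 := by
      rw [norm_sq3]
      linarith
    simpa using this
  · rintro rfl
    simp

theorem isStableEquilibrium_zero {lam : ℕ} (hlam : lam ≠ 0) :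
    IsStableEquilibrium (field lam) 0 := by
  refine isStableEquilibrium_of_isolated hlam (ext3 (by simp) (by simp) (by simp)) one_pos
    fun p hp _ => ?_
  have h0 : EC lam 0 = (0, 0) := by simp [EC]
  have : p ∈ fiber lam (0, 0) := hp.trans h0
  rwa [fiber_zero_zero] at this

/-! ### The energy-Casimir inequality -/

/-- Weighted AM-GM for `a * b ^ n`, cleared of denominators, with its equality case. -/
theorem mul_mul_pow_le {n : ℕ} (hn : n ≠ 0) {a b : ℝ} (ha : 0 ≤ a) (hb : 0 ≤ b) :
    n * (a * b ^ n) ≤ (n * ((a + b) / (n + 1))) ^ (n + 1) ∧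
      (n * (a * b ^ n) = (n * ((a + b) / (n + 1))) ^ (n + 1) → b = n * a) := by
  have hn' : (0 : ℝ) < n := by positivity
  have hn1 : (0 : ℝ) < n + 1 := by positivity
  rcases hb.eq_or_lt with rfl | hb
  · simp only [zero_pow hn, mul_zero, add_zero]
    refine ⟨by positivity, fun h => ?_⟩
    have := eq_zero_of_pow_eq_zero h.symm
    rcases mul_eq_zero.1 this with h | h
    · exact absurd h hn'.ne'
    · rcases div_eq_zero_iff.1 h with h | h
      · rw [h, mul_zero]
      · exact absurd h hn1.ne'
  -- In terms of `v` the claim is Bernoulli's inequality `1 + (n + 1) (v - 1) ≤ v ^ (n + 1)` times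
  -- `b ^ (n + 1)`. Bernoulli is strict unless `v = 1`, that is, `b = n * a`.
  · set v := n * ((a + b) / (n + 1)) / b with hv
    have hv0 : 0 ≤ v := by positivity
    have hvb : n * ((a + b) / (n + 1)) = b * v := by
      rw [hv]
      field_simp
    have hlin : b ^ (n + 1) * (1 + ((n + 1 : ℕ) : ℝ) * (v - 1)) = n * (a * b ^ n) := by
      have : b * ((n + 1) * v) = n * (a + b) := by
        rw [← mul_assoc, mul_comm b, mul_assoc, ← hvb]
        field_simp
      push_cast
      rw [pow_succ]
      linear_combination b ^ n * this
    rw [hvb, mul_pow, ← hlin]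
    refine ⟨mul_le_mul_of_nonneg_left ?_ (by positivity), fun h => ?_⟩
    · simpa using one_add_mul_le_pow (a := v - 1) (by linarith) (n + 1)
    · have h' := mul_left_cancel₀ (pow_pos hb (n + 1)).ne' h
      have hv1 : v = 1 := by
        by_contra hne
        have := one_add_mul_self_lt_rpow_one_add (s := v - 1) (by linarith) (sub_ne_zero.2 hne)
          (p := ((n + 1 : ℕ) : ℝ)) (by push_cast; linarith)
        rw [Real.rpow_natCast, add_sub_cancel] at this
        exact this.ne h'
      rw [hv1, mul_one, ← mul_div_assoc, div_eq_iff hn1.ne'] at hvb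
      linarith

/-- Multiplication by `n` turns the bound defining the strata into the perfect power produced by
`mul_mul_pow_le`. -/
theorem bound_eq (n : ℕ) (c : ℝ) :
    n * ((n : ℝ) ^ n * (2 / ((n : ℝ) + 1)) ^ (n + 1) * c ^ (n + 1)) =
      (n * (2 * c / (n + 1))) ^ (n + 1) := by
  rw [mul_div_right_comm, mul_pow, mul_pow, pow_succ (n : ℝ) n]
  ring

theorem sq_casimir (n : ℕ) (p : R3) : (p 0 * p 1 ^ n) ^ 2 = p 0 ^ 2 * (p 1 ^ 2) ^ n := by
  rw [mul_pow, ← pow_mul, ← pow_mul, mul_comm n 2]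

/-- The bound defining the principal strata holds on all of phase space. Equality holds only at
the equilibria with `z = 0` and `y² = lam x²`. -/
theorem casimir_sq_le {lam : ℕ} (hlam : lam ≠ 0) (p : R3) :
    (EC lam p).1 ^ 2 ≤
        (lam : ℝ) ^ lam * (2 / ((lam : ℝ) + 1)) ^ (lam + 1) * (EC lam p).2 ^ (lam + 1) ∧
      ((EC lam p).1 ^ 2 =
        (lam : ℝ) ^ lam * (2 / ((lam : ℝ) + 1)) ^ (lam + 1) * (EC lam p).2 ^ (lam + 1) →
          p 2 = 0 ∧ p 1 ^ 2 = lam * p 0 ^ 2) := by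
  have hn : (0 : ℝ) < lam := by positivity
  obtain ⟨hle, heq⟩ := mul_mul_pow_le hlam (sq_nonneg (p 0)) (sq_nonneg (p 1))
  have h2c : 2 * (EC lam p).2 = p 0 ^ 2 + p 1 ^ 2 + p 2 ^ 2 := by
    simp only [EC]
    ring
  have hsum : lam * ((p 0 ^ 2 + p 1 ^ 2) / (lam + 1)) ≤
      (lam : ℝ) * (2 * (EC lam p).2 / (lam + 1)) := by
    rw [h2c]
    exact mul_le_mul_of_nonneg_left (div_le_div_of_nonneg_right
      (by linarith [sq_nonneg (p 2)]) (by positivity)) hn.le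
  have hnn : 0 ≤ lam * ((p 0 ^ 2 + p 1 ^ 2) / ((lam : ℝ) + 1)) := by positivity
  have hpow := pow_le_pow_left₀ hnn hsum (lam + 1)
  have hsq : (EC lam p).1 ^ 2 = p 0 ^ 2 * (p 1 ^ 2) ^ lam := sq_casimir lam p
  refine ⟨le_of_mul_le_mul_left ?_ hn, fun h => ?_⟩
  · rw [bound_eq, hsq]
    exact hle.trans hpow
  · have h' := congrArg (fun x => (lam : ℝ) * x) h
    simp only [bound_eq, hsq] at h'
    -- Two inequalities were chained, so both are equalities: AM-GM gives `y² = lam x²`, and the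
    -- dropped term `z²` must vanish.
    refine ⟨?_, heq (hle.antisymm (hpow.trans h'.ge))⟩
    have := (pow_left_inj₀ hnn (hnn.trans hsum) (Nat.succ_ne_zero lam)).1
      (hpow.antisymm (h'.ge.trans hle))
    rw [h2c] at this
    field_simp at this
    simpa using this

/-! ### The critical strata -/

theorem eq_mul_sqrt_or {lam : ℕ} {x y : ℝ} (h : y ^ 2 = lam * x ^ 2) :
    y = x * √(lam : ℝ) ∨ y = -(x * √(lam : ℝ)) := by
  refine sq_eq_sq_iff_eq_or_eq_neg.1 ?_
  rw [mul_pow, Real.sq_sqrt lam.cast_nonneg, h, mul_comm]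

theorem mem_equilibriaSStar {lam : ℕ} {p : R3} :
    p ∈ equilibriaSStar lam ↔ p 0 ≠ 0 ∧ p 2 = 0 ∧ p 1 ^ 2 = lam * p 0 ^ 2 := by
  constructor
  · rintro ⟨M, hM, rfl | rfl⟩ <;>
      simp [hM, mul_pow, Real.sq_sqrt lam.cast_nonneg, mul_comm]
  · rintro ⟨h0, h2, h1⟩
    refine ⟨p 0, h0, ?_⟩
    rcases eq_mul_sqrt_or h1 with h | h
    · exact Or.inr (ext3 rfl h h2)
    · exact Or.inl (ext3 rfl h h2)

theorem field_eq_zero_of_mem_equilibriaSStar {lam : ℕ} {p : R3} (hp : p ∈ equilibriaSStar lam) :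
    field lam p = 0 := by
  obtain ⟨-, h2, h1⟩ := mem_equilibriaSStar.1 hp
  exact ext3 (by simp [h2]) (by simp [h2]) (by simp [h1])

theorem casimir_sq_eq_of_mem_equilibriaSStar {lam : ℕ} (hlam : lam ≠ 0) {p : R3}
    (hp : p ∈ equilibriaSStar lam) : (EC lam p).1 ^ 2 =
      (lam : ℝ) ^ lam * (2 / ((lam : ℝ) + 1)) ^ (lam + 1) * (EC lam p).2 ^ (lam + 1) := by
  obtain ⟨-, h2, h1⟩ := mem_equilibriaSStar.1 hp
  have hn : (lam : ℝ) ≠ 0 := by positivity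
  have hn1 : (lam : ℝ) + 1 ≠ 0 := by positivity
  refine mul_left_cancel₀ hn ?_
  rw [bound_eq]
  have hsq : (EC lam p).1 ^ 2 = p 0 ^ 2 * (p 1 ^ 2) ^ lam := sq_casimir lam p
  have hc : 2 * (EC lam p).2 / (lam + 1) = p 0 ^ 2 := by
    rw [div_eq_iff hn1]
    simp only [EC, h1, h2]
    ring
  rw [hsq, hc, h1, pow_succ]
  ring

/-- The symmetry exchanging the two halves of a fiber. -/
def flip (lam : ℕ) (p : R3) : R3 := !₂[(-1) ^ lam * p 0, -p 1, p 2]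

theorem neg_one_pow_sq (n : ℕ) : ((-1 : ℝ) ^ n) ^ 2 = 1 := by
  rw [← pow_mul, mul_comm, pow_mul, neg_one_sq, one_pow]

/-- The factor `(-1) ^ lam` on `x` compensates the sign of `(-y) ^ lam`, for either parity of `lam`.
-/
theorem EC_flip (lam : ℕ) (p : R3) : EC lam (flip lam p) = EC lam p := by
  refine Prod.ext ?_ ?_
  · change (-1) ^ lam * p 0 * (-p 1) ^ lam = p 0 * p 1 ^ lam
    rw [neg_pow (p 1)]
    linear_combination (p 0 * p 1 ^ lam) * neg_one_pow_sq lam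
  · change (((-1) ^ lam * p 0) ^ 2 + (-p 1) ^ 2 + p 2 ^ 2) / 2 = (p 0 ^ 2 + p 1 ^ 2 + p 2 ^ 2) / 2
    rw [mul_pow, neg_one_pow_sq]
    ring

theorem flip_mem_equilibriaSStar {lam : ℕ} {p : R3} (hp : p ∈ equilibriaSStar lam) :
    flip lam p ∈ equilibriaSStar lam := by
  obtain ⟨h0, h2, h1⟩ := mem_equilibriaSStar.1 hp
  refine mem_equilibriaSStar.2 ⟨?_, h2, ?_⟩
  · simpa [flip] using h0
  · change (-p 1) ^ 2 = lam * ((-1) ^ lam * p 0) ^ 2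
    rw [mul_pow, neg_one_pow_sq, neg_sq, h1, one_mul]

theorem apply_one_ne_zero {lam : ℕ} (hlam : lam ≠ 0) {p : R3} (hp : p ∈ equilibriaSStar lam) :
    p 1 ≠ 0 := by
  obtain ⟨h0, -, h1⟩ := mem_equilibriaSStar.1 hp
  intro h
  rw [h, zero_pow two_ne_zero, eq_comm] at h1
  simp [hlam, h0] at h1

theorem flip_ne {lam : ℕ} (hlam : lam ≠ 0) {p : R3} (hp : p ∈ equilibriaSStar lam) :
    p ≠ flip lam p := fun h => by
  have h1 : p 1 = -p 1 := congrArg (fun p : R3 => p 1) h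
  exact apply_one_ne_zero hlam hp (by linarith)

/-- The fiber through an equilibrium with `z = 0` consists of it and its mirror image. -/
theorem fiber_eq_pair {lam : ℕ} (hlam : lam ≠ 0) {e : R3} (he : e ∈ equilibriaSStar lam) :
    fiber lam (EC lam e) = {e, flip lam e} := by
  ext p
  constructor
  · intro hp
    have hp : EC lam p = EC lam e := hp
    obtain ⟨h2, h1⟩ := (casimir_sq_le hlam p).2 (hp ▸ casimir_sq_eq_of_mem_equilibriaSStar hlam he)
    obtain ⟨-, he2, he1⟩ := mem_equilibriaSStar.1 he
    have hcas : p 0 * p 1 ^ lam = e 0 * e 1 ^ lam := congrArg Prod.fst hp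
    have hen : (p 0 ^ 2 + p 1 ^ 2 + p 2 ^ 2) / 2 = (e 0 ^ 2 + e 1 ^ 2 + e 2 ^ 2) / 2 :=
      congrArg Prod.snd hp
    have hn1 : (lam : ℝ) + 1 ≠ 0 := by positivity
    have h0 : p 0 ^ 2 = e 0 ^ 2 := by
      rw [h2, he2, h1, he1] at hen
      refine mul_left_cancel₀ hn1 ?_
      linarith
    have hy : p 1 ^ 2 = e 1 ^ 2 := by rw [h1, he1, h0]
    have hpow : e 1 ^ lam ≠ 0 := pow_ne_zero _ (apply_one_ne_zero hlam he)
    rcases sq_eq_sq_iff_eq_or_eq_neg.1 hy with h | h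
    · refine Or.inl (ext3 ?_ h (h2.trans he2.symm))
      rw [h] at hcas
      exact mul_right_cancel₀ hpow hcas
    · refine Or.inr (ext3 ?_ h (h2.trans he2.symm))
      rw [h, neg_pow] at hcas
      change p 0 = (-1) ^ lam * e 0
      refine mul_right_cancel₀ hpow ?_
      linear_combination (-1) ^ lam * hcas - p 0 * e 1 ^ lam * neg_one_pow_sq lam
  · rintro (rfl | rfl)
    · rfl
    · exact EC_flip lam e

theorem isStableEquilibrium_of_mem_equilibriaSStar {lam : ℕ} (hlam : lam ≠ 0) {e : R3}
    (he : e ∈ equilibriaSStar lam) : IsStableEquilibrium (field lam) e := by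
  -- The radius is the distance to the only other point of the fiber.
  refine isStableEquilibrium_of_isolated hlam (field_eq_zero_of_mem_equilibriaSStar he)
    (ε₀ := dist (flip lam e) e) (dist_pos.2 (flip_ne hlam he).symm) fun p hp hd => ?_
  have hp : p ∈ fiber lam (EC lam e) := hp
  rw [fiber_eq_pair hlam he] at hp
  rcases hp with h | h
  · exact h
  · rw [h] at hd
    exact absurd hd (lt_irrefl _)

theorem exists_of_mem_sigmaS {lam : ℕ} {q : ℝ × ℝ} (hq : q ∈ sigmaSPlus lam ∪ sigmaSMinus lam) :
    ∃ e ∈ equilibriaSStar lam, EC lam e = q := by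
  rcases hq with ⟨h, -⟩ | ⟨h, -⟩ <;> exact h

/-! ### The effective potential -/

/-- On the level `h` of the Casimir function, `x² + y²` as a function of `Y = y²`. -/
def potential (lam : ℕ) (h Y : ℝ) : ℝ := Y + h ^ 2 / Y ^ lam

theorem strictConvexOn_potential {lam : ℕ} (hlam : lam ≠ 0) {h : ℝ} (hh : h ≠ 0) :
    StrictConvexOn ℝ (Ioi 0) (potential lam h) := by
  have h1 : StrictConvexOn ℝ (Ioi (0 : ℝ)) fun x => x ^ (-(lam : ℤ)) :=
    strictConvexOn_zpow (by simpa using hlam) (by omega)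
  have h2 : 0 < h ^ 2 := by positivity
  refine ⟨convex_Ioi 0, fun x hx y hy hxy a b ha hb hab => ?_⟩
  have := h1.2 hx hy hxy ha hb hab
  simp only [zpow_neg, zpow_natCast, smul_eq_mul, potential, div_eq_mul_inv] at this ⊢
  have := mul_lt_mul_of_pos_left this h2
  linarith

/-- With two points at level `2c`, no point outside the interval between them can have potential at
most `2c`. -/
theorem potential_lt_max {lam : ℕ} (hlam : lam ≠ 0) {h a b d : ℝ} (hh : h ≠ 0) (ha : 0 < a)
    (hab : a < b) (hbd : b < d) :
    potential lam h b < max (potential lam h a) (potential lam h d) :=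
  (strictConvexOn_potential hlam hh).lt_on_openSegment ha (ha.trans (hab.trans hbd))
    (hab.trans hbd).ne (by rw [openSegment_eq_Ioo (hab.trans hbd)]; exact ⟨hab, hbd⟩)

theorem continuousOn_potential (lam : ℕ) (h : ℝ) : ContinuousOn (potential lam h) (Ioi 0) :=
  continuousOn_id.add (continuousOn_const.div (continuousOn_id.pow lam)
    fun _ hx => pow_ne_zero lam (ne_of_gt hx))

/-- Over the principal strata the minimum of the potential lies below the energy level. -/
theorem exists_potential_lt {lam : ℕ} (hlam : lam ≠ 0) {h c : ℝ} (hh : h ≠ 0) (hc : 0 < c)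
    (hlt : h ^ 2 < (lam : ℝ) ^ lam * (2 / ((lam : ℝ) + 1)) ^ (lam + 1) * c ^ (lam + 1)) :
    ∃ Y₀, 0 < Y₀ ∧ Y₀ ^ (lam + 1) = lam * h ^ 2 ∧ potential lam h Y₀ < 2 * c := by
  have hn : (0 : ℝ) < lam := by positivity
  have hpos : 0 < lam * h ^ 2 := by positivity
  -- This is the zero of the derivative `1 - lam h² / Y ^ (lam + 1)`. There `h² / Y₀ ^ lam = Y₀ /
  -- lam`, so the minimum is `Y₀ (lam + 1) / lam`, and comparing it with `2c` is the `(lam + 1)`-th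
  -- root of the hypothesis.
  refine ⟨(lam * h ^ 2) ^ (((lam + 1 : ℕ) : ℝ)⁻¹), Real.rpow_pos_of_pos hpos _,
    Real.rpow_inv_natCast_pow hpos.le (Nat.succ_ne_zero lam), ?_⟩
  set Y₀ := (lam * h ^ 2) ^ (((lam + 1 : ℕ) : ℝ)⁻¹) with hY₀
  have hY : 0 < Y₀ := Real.rpow_pos_of_pos hpos _
  have hpow : Y₀ ^ (lam + 1) = lam * h ^ 2 :=
    Real.rpow_inv_natCast_pow hpos.le (Nat.succ_ne_zero lam)
  have hdiv : h ^ 2 / Y₀ ^ lam = Y₀ / lam := by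
    rw [div_eq_div_iff (pow_pos hY lam).ne' hn.ne', ← pow_succ', hpow, mul_comm]
  have hlt' : Y₀ < lam * (2 * c / (lam + 1)) := by
    refine lt_of_pow_lt_pow_left₀ (lam + 1) (by positivity) ?_
    rw [hpow, ← bound_eq]
    exact mul_lt_mul_of_pos_left hlt hn
  rw [potential, hdiv]
  rw [← mul_div_assoc, lt_div_iff₀ (by positivity)] at hlt'
  have : Y₀ + Y₀ / lam = Y₀ * (lam + 1) / lam := by field_simp
  rw [this, div_lt_iff₀ hn]
  linarith

theorem exists_lower_turning_point {lam : ℕ} (hlam : lam ≠ 0) {h c Y₀ : ℝ} (hh : h ≠ 0)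
    (hY₀ : 0 < Y₀) (hlt : potential lam h Y₀ < 2 * c) :
    ∃ Y₁, 0 < Y₁ ∧ Y₁ < Y₀ ∧ potential lam h Y₁ = 2 * c := by
  have hh2 : 0 < h ^ 2 := by positivity
  have hc : 0 < 2 * c := lt_trans (by unfold potential; positivity) hlt
  -- The bound `a ≤ 1` gives `a ^ lam ≤ a`, and `a ≤ h² / (2c)` then makes the potential at `a` at
  -- least `2c`.
  set a := min Y₀ (min (h ^ 2 / (2 * c)) 1) with ha
  have ha0 : 0 < a := lt_min hY₀ (lt_min (by positivity) one_pos)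
  have ha1 : a ≤ 1 := (min_le_right _ _).trans (min_le_right _ _)
  have hac : a ≤ h ^ 2 / (2 * c) := (min_le_right _ _).trans (min_le_left _ _)
  have hbig : 2 * c ≤ potential lam h a := by
    have h1 : 2 * c ≤ h ^ 2 / a ^ lam := by
      rw [le_div_iff₀ (pow_pos ha0 lam)]
      rw [le_div_iff₀ hc] at hac
      calc 2 * c * a ^ lam ≤ 2 * c * a :=
            mul_le_mul_of_nonneg_left (pow_le_of_le_one ha0.le ha1 hlam) hc.le
        _ ≤ h ^ 2 := by linarith
    unfold potential
    linarith
  obtain ⟨Y, hY, hYc⟩ := intermediate_value_Icc' (min_le_left _ _ : a ≤ Y₀)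
    ((continuousOn_potential lam h).mono fun x hx => ha0.trans_le hx.1) ⟨hlt.le, hbig⟩
  refine ⟨Y, ha0.trans_le hY.1, lt_of_le_of_ne hY.2 ?_, hYc⟩
  rintro rfl
  exact hlt.ne hYc

/-- Since `h ≠ 0` forbids `y = 0`, a fiber point is determined by `y` and `z`, subject to a
one-dimensional energy equation. -/
theorem apply_zero_sq {lam : ℕ} {h c : ℝ} (hh : h ≠ 0) (hlam : lam ≠ 0) {p : R3}
    (hp : p ∈ fiber lam (h, c)) :
    p 1 ≠ 0 ∧ p 0 = h / p 1 ^ lam ∧ p 0 ^ 2 = h ^ 2 / (p 1 ^ 2) ^ lam ∧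
      potential lam h (p 1 ^ 2) + p 2 ^ 2 = 2 * c := by
  obtain ⟨h1, h2⟩ := mem_fiber.1 hp
  have hy : p 1 ≠ 0 := by
    intro h0
    rw [h0, zero_pow hlam, mul_zero] at h1
    exact hh h1.symm
  have hx : p 0 = h / p 1 ^ lam := by
    rw [eq_div_iff (pow_ne_zero _ hy), h1]
  have hx2 : p 0 ^ 2 = h ^ 2 / (p 1 ^ 2) ^ lam := by
    rw [hx, div_pow, ← pow_mul, ← pow_mul, mul_comm]
  refine ⟨hy, hx, hx2, ?_⟩
  rw [potential, ← hx2]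
  linarith

/-! ### Real-variable lemmas -/

/-- By the mean value theorem `f (t + 1) - f t`, which tends to `0`, is a value of `f'` at a point
beyond `t`. -/
theorem eq_zero_of_tendsto_deriv {f f' : ℝ → ℝ} {a b : ℝ} (hf : ∀ t, HasDerivAt f (f' t) t)
    (ha : Tendsto f' atTop (𝓝 a)) (hb : Tendsto f atTop (𝓝 b)) : a = 0 := by
  have h : ∀ t : ℝ, ∃ ξ ∈ Ioo t (t + 1), f' ξ = f (t + 1) - f t := by
    intro t
    obtain ⟨ξ, hξ, h⟩ := exists_hasDerivAt_eq_slope f f' (lt_add_one t)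
      (fun x _ => (hf x).continuousAt.continuousWithinAt) (fun x _ => hf x)
    exact ⟨ξ, hξ, by simpa using h⟩
  choose ξ hξ h using h
  have hξt : Tendsto ξ atTop atTop := tendsto_atTop_mono (fun t => (hξ t).1.le) tendsto_id
  have h1 : Tendsto (fun t => f (t + 1) - f t) atTop (𝓝 (b - b)) :=
    (hb.comp (tendsto_atTop_add_const_right _ _ tendsto_id)).sub hb
  rw [sub_self] at h1
  exact tendsto_nhds_unique ((ha.comp hξt).congr h) h1

theorem exists_first_zero {z : ℝ → ℝ} (hz : Continuous z) {d t : ℝ} (hdt : d ≤ t) (hd : z d < 0)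
    (ht : 0 ≤ z t) : ∃ T, d < T ∧ z T = 0 ∧ ∀ s, d ≤ s → s < T → z s < 0 := by
  set S := Ici d ∩ z ⁻¹' Ici 0 with hS
  have hcl : IsClosed S := isClosed_Ici.inter (isClosed_Ici.preimage hz)
  have hbdd : BddBelow S := ⟨d, fun s hs => hs.1⟩
  have hmem : sInf S ∈ S := hcl.csInf_mem ⟨t, hdt, ht⟩ hbdd
  have hbefore : ∀ s, d ≤ s → s < sInf S → z s < 0 := fun s hs hsT => by
    by_contra! hcon
    exact absurd (csInf_le hbdd ⟨hs, hcon⟩) (not_le.2 hsT)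
  have hne : d < sInf S := lt_of_le_of_ne hmem.1 fun h => by
    have : 0 ≤ z (sInf S) := hmem.2
    rw [← h] at this
    linarith
  refine ⟨sInf S, hne, ?_, hbefore⟩
  obtain ⟨s, hs, hs0⟩ := intermediate_value_Icc hmem.1 hz.continuousOn ⟨hd.le, hmem.2⟩
  rcases hs.2.eq_or_lt with h | h
  · rwa [← h]
  · exact absurd hs0 (hbefore s hs.1 h).ne

theorem pos_of_continuous_of_ne_zero {f : ℝ → ℝ} (hf : Continuous f) (hne : ∀ t, f t ≠ 0)
    {t₀ : ℝ} (h₀ : 0 < f t₀) (t : ℝ) : 0 < f t := by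
  by_contra! h
  obtain ⟨s, hs⟩ := mem_range_of_exists_le_of_exists_ge hf ⟨t, h⟩ ⟨t₀, h₀.le⟩
  exact hne s hs

/-! ### Periodic orbits -/

/-- A solution starting at the lower turning point reaches the upper one. -/
theorem exists_upper_turning_time {lam : ℕ} (hlam : lam ≠ 0) {h c Y₀ : ℝ} (hh : h ≠ 0)
    (hY₀ : 0 < Y₀) (hpow : Y₀ ^ (lam + 1) = lam * h ^ 2) (hlt : potential lam h Y₀ < 2 * c)
    {γ : ℝ → R3} (hγ : IsSolution (field lam) γ) (hfib : ∀ t, γ t ∈ fiber lam (h, c))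
    (hz0 : γ 0 2 = 0) (hu0 : γ 0 1 ^ 2 < Y₀) :
    ∃ T, 0 < T ∧ γ T 2 = 0 ∧ γ 0 1 ^ 2 < γ T 1 ^ 2 := by
  have hfacts := fun t => apply_zero_sq hh hlam (hfib t)
  have hupos : ∀ t, 0 < γ t 1 ^ 2 := fun t => by
    have := (hfacts t).1
    positivity
  have hu' : ∀ t, HasDerivAt (fun t => γ t 1 ^ 2) (-2 * γ t 1 ^ 2 * γ t 2) t := fun t => by
    refine ((hasDerivAt_coord hγ t 1).pow 2).congr_deriv ?_
    simp only [field_one]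
    ring
  have hz' : ∀ t, HasDerivAt (fun t => γ t 2) (γ t 1 ^ 2 - lam * (h ^ 2 / (γ t 1 ^ 2) ^ lam)) t :=
    fun t => (hasDerivAt_coord hγ t 2).congr_deriv (by rw [field_two, (hfacts t).2.2.1])
  have huc : Continuous fun t => γ t 1 ^ 2 :=
    continuous_iff_continuousAt.2 fun t => (hu' t).continuousAt
  have hzc : Continuous fun t => γ t 2 :=
    continuous_iff_continuousAt.2 fun t => (hz' t).continuousAt
  -- Left of the critical point `Y₀` the derivative of `z` is negative, so `z` becomes negative just
  -- after time `0`.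
  have hforce : γ 0 1 ^ 2 - lam * (h ^ 2 / (γ 0 1 ^ 2) ^ lam) < 0 := by
    have : (γ 0 1 ^ 2) ^ (lam + 1) < Y₀ ^ (lam + 1) :=
      pow_lt_pow_left₀ hu0 (hupos 0).le (Nat.succ_ne_zero lam)
    rw [sub_neg, ← mul_div_assoc, lt_div_iff₀ (pow_pos (hupos 0) lam), ← pow_succ', ← hpow]
    exact this
  have hnear : ∀ᶠ t in 𝓝[>] (0 : ℝ), γ t 2 < 0 := by
    have hlim := (hz' 0).tendsto_slope_zero_right
    filter_upwards [hlim.eventually (gt_mem_nhds hforce), self_mem_nhdsWithin] with t ht htpos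
    rw [zero_add, hz0, sub_zero, smul_eq_mul] at ht
    exact neg_of_mul_neg_right ht (inv_pos.2 htpos).le
  obtain ⟨δ, hδ, hδz⟩ := mem_nhdsGT_iff_exists_Ioo_subset.1 hnear
  have hδ : (0 : ℝ) < δ := hδ
  by_contra! hcon
  -- Since `(y²)' = -2 y² z`, the function `y²` increases as long as `z < 0`. Under `hcon` this
  -- rules out any later zero of `z`.
  have hmono : ∀ T, (∀ s, 0 < s → s < T → γ s 2 < 0) →
      StrictMonoOn (fun t => γ t 1 ^ 2) (Icc 0 T) := by
    intro T hT
    refine strictMonoOn_of_hasDerivWithinAt_pos (convex_Icc 0 T) huc.continuousOn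
      (fun t _ => (hu' t).hasDerivWithinAt) fun t ht => ?_
    rw [interior_Icc] at ht
    have := mul_pos (hupos t) (neg_pos.2 (hT t ht.1 ht.2))
    linarith
  have hneg : ∀ t, 0 < t → γ t 2 < 0 := by
    intro t ht
    by_contra! hge
    have hδt : δ ≤ t := by
      by_contra! hlt
      exact absurd (hδz ⟨ht, hlt⟩ : γ t 2 < 0) (not_lt.2 hge)
    -- The search starts at `δ / 2` because `z` vanishes at `0` itself.
    obtain ⟨T, hT, hzT, hbefore⟩ := exists_first_zero hzc (d := δ / 2) (by linarith)
      (hδz ⟨by linarith, by linarith⟩ : γ (δ / 2) 2 < 0) hge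
    have hbefore' : ∀ s, 0 < s → s < T → γ s 2 < 0 := fun s hs hsT => by
      rcases lt_or_ge s δ with hsδ | hsδ
      · exact hδz ⟨hs, hsδ⟩
      · exact hbefore s (by linarith) hsT
    have hT0 : 0 < T := by linarith
    have := hmono T hbefore' (left_mem_Icc.2 hT0.le) (right_mem_Icc.2 hT0.le) hT0
    exact absurd this (not_lt.2 (hcon T hT0 hzT))
  -- Clamping time at `0` gives a function monotone on all of `ℝ`, with the same limit at infinity.
  have hmonoU : Monotone fun t => γ (max 0 t) 1 ^ 2 := by
    intro s t hst
    have hle : max 0 s ≤ max 0 t := max_le_max_left 0 hst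
    exact (hmono (max 0 t) fun r hr _ => hneg r hr).monotoneOn
      ⟨le_max_left _ _, hle⟩ ⟨le_max_left _ _, le_rfl⟩ hle
  have hbdd : BddAbove (range fun t => γ (max 0 t) 1 ^ 2) := by
    refine ⟨2 * c, ?_⟩
    rintro _ ⟨t, rfl⟩
    have := (mem_fiber.1 (hfib (max 0 t))).2
    dsimp only
    linarith [sq_nonneg (γ (max 0 t) 0), sq_nonneg (γ (max 0 t) 2)]
  set Y := ⨆ t, γ (max 0 t) 1 ^ 2 with hY
  have hlimU : Tendsto (fun t => γ t 1 ^ 2) atTop (𝓝 Y) := by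
    refine (tendsto_atTop_ciSup hmonoU hbdd).congr' ?_
    filter_upwards [eventually_ge_atTop (0 : ℝ)] with t ht
    rw [max_eq_right ht]
  have hYpos : 0 < Y := (hupos _).trans_le (le_ciSup hbdd 0)
  have hlimW : Tendsto (fun t => potential lam h (γ t 1 ^ 2)) atTop (𝓝 (potential lam h Y)) :=
    (((continuousOn_potential lam h).continuousAt (Ioi_mem_nhds hYpos)).tendsto).comp hlimU
  set m := √(2 * c - potential lam h Y) with hm
  have hlimZ : Tendsto (fun t => γ t 2) atTop (𝓝 (-m)) := by
    have h1 : Tendsto (fun t => -√(2 * c - potential lam h (γ t 1 ^ 2))) atTop (𝓝 (-m)) :=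
      ((Real.continuous_sqrt.tendsto _).comp (hlimW.const_sub (2 * c))).neg
    refine h1.congr' ?_
    filter_upwards [eventually_gt_atTop (0 : ℝ)] with t ht
    rw [← (hfacts t).2.2.2, add_sub_cancel_left, Real.sqrt_sq_eq_abs, abs_of_neg (hneg t ht),
      neg_neg]
  -- Now `y²` and `z` converge, so the limits of their derivatives vanish. The first gives `m = 0`,
  -- hence potential `2c` at `Y`; the second gives `Y = Y₀`, where the potential is below `2c`.
  have hm0 : m = 0 := by
    have := eq_zero_of_tendsto_deriv hu' ((hlimU.const_mul (-2)).mul hlimZ) hlimU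
    simpa [hYpos.ne'] using this
  have hW : potential lam h Y = 2 * c := by
    have h1 : 2 * c - potential lam h Y ≤ 0 := Real.sqrt_eq_zero'.1 hm0
    have h2 : potential lam h Y ≤ 2 * c := le_of_tendsto hlimW (Eventually.of_forall fun t => by
      linarith [(hfacts t).2.2.2, sq_nonneg (γ t 2)])
    linarith
  have hYY₀ : Y = Y₀ := by
    have h1 : Tendsto (fun t => γ t 1 ^ 2 - lam * (h ^ 2 / (γ t 1 ^ 2) ^ lam)) atTop
        (𝓝 (Y - lam * (h ^ 2 / Y ^ lam))) :=
      hlimU.sub ((tendsto_const_nhds.div (hlimU.pow lam) (pow_pos hYpos lam).ne').const_mul _)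
    have h2 := eq_zero_of_tendsto_deriv hz' h1 hlimZ
    rw [sub_eq_zero, ← mul_div_assoc, eq_div_iff (pow_pos hYpos lam).ne', ← pow_succ', ← hpow] at h2
    exact (pow_left_inj₀ hYpos.le hY₀.le (Nat.succ_ne_zero lam)).1 h2
  rw [hYY₀] at hW
  exact hlt.ne hW

/-- The half of a principal fiber on which `y` has the sign of `σ` is a periodic orbit and a
circle. -/
theorem exists_periodic_half_fiber {lam : ℕ} (hlam : lam ≠ 0) {h c σ : ℝ} (hh : h ≠ 0) (hc : 0 < c)
    (hlt : h ^ 2 < (lam : ℝ) ^ lam * (2 / ((lam : ℝ) + 1)) ^ (lam + 1) * c ^ (lam + 1))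
    (hσ : σ ^ 2 = 1) :
    IsPeriodicOrbit (field lam) {p ∈ fiber lam (h, c) | 0 < σ * p 1} ∧
      ∃ f : Circle → R3, Continuous f ∧ Function.Injective f ∧
        range f = {p ∈ fiber lam (h, c) | 0 < σ * p 1} := by
  obtain ⟨Y₀, hY₀, hpow, hmin⟩ := exists_potential_lt hlam hh hc hlt
  obtain ⟨Y₁, hY₁, hY₁₀, hW₁⟩ := exists_lower_turning_point hlam hh hY₀ hmin
  set y := σ * √Y₁ with hy
  have hσ0 : σ ≠ 0 := by
    rintro rfl
    simp at hσ
  have hsqrt : 0 < √Y₁ := Real.sqrt_pos.2 hY₁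
  have hy2 : y ^ 2 = Y₁ := by rw [hy, mul_pow, hσ, one_mul, Real.sq_sqrt hY₁.le]
  have hy0 : y ≠ 0 := mul_ne_zero hσ0 hsqrt.ne'
  obtain ⟨γ, hγ, hγ0⟩ := exists_isSolution lam !₂[h / y ^ lam, y, 0]
  have h00 : γ 0 0 = h / y ^ lam := by rw [hγ0]; rfl
  have h01 : γ 0 1 = y := by rw [hγ0]; rfl
  have h02 : γ 0 2 = 0 := by rw [hγ0]; rfl
  have hfib0 : γ 0 ∈ fiber lam (h, c) := by
    rw [mem_fiber, h00, h01, h02]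
    refine ⟨div_mul_cancel₀ _ (pow_ne_zero _ hy0), ?_⟩
    rw [div_pow, ← pow_mul, mul_comm lam 2, pow_mul, hy2]
    rw [potential] at hW₁
    linarith
  have hfib : ∀ t, γ t ∈ fiber lam (h, c) := fun t =>
    (EC_eq_of_isSolution hlam hγ t 0).trans hfib0
  have hfacts := fun t => apply_zero_sq hh hlam (hfib t)
  have hcont := IsIntegralCurve.continuous hγ
  have hyc : Continuous fun t => γ t 1 := (EuclideanSpace.proj (𝕜 := ℝ) (1 : Fin 3)).continuous.comp
    hcont
  have hsign : ∀ t, 0 < σ * γ t 1 := by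
    refine pos_of_continuous_of_ne_zero (continuous_const.mul hyc)
      (fun t => mul_ne_zero hσ0 (hfacts t).1) (t₀ := 0) ?_
    rw [h01, hy, ← mul_assoc, ← sq, hσ, one_mul]
    exact hsqrt
  obtain ⟨T, hT, hzT, huT⟩ := exists_upper_turning_time hlam hh hY₀ hpow hmin hγ hfib h02
    (by rwa [h01, hy2])
  rw [h01, hy2] at huT
  -- As `z = 0` at time `0`, the initial point is fixed by the reversing symmetry, and uniqueness
  -- makes the whole solution symmetric.
  have hrefl : ∀ t, γ (-t) = !₂[γ t 0, γ t 1, -γ t 2] := by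
    intro t
    have := isSolution_eq hlam (isSolution_reverse hγ 0) hγ (t₀ := 0)
      (by rw [sub_zero]; exact ext3 rfl rfl (by simp [h02]))
    simpa using (congrFun this (-t)).symm
  have hTT : γ T = γ (-T) := by
    rw [hrefl]
    exact ext3 rfl rfl (by simp [hzT])
  -- At the upper turning point `z = 0` again, so `γ T = γ (-T)` and `2T` is a period.
  have hper : Function.Periodic γ (T - -T) := periodic_of_eq hlam hγ hTT
  have hT2 : 0 < T - -T := by linarith
  have hne : ∃ s t, γ s ≠ γ t := ⟨T, 0, fun h => by
    rw [h, h01, hy2] at huT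
    exact lt_irrefl _ huT⟩
  have hWT : potential lam h (γ T 1 ^ 2) = 2 * c := by
    simpa [hzT] using (hfacts T).2.2.2
  -- Convexity puts `p 1 ^ 2` between the turning values, so it is attained at some `t` in `[0, T]`.
  -- The sign `σ` then fixes `y` and `x`, and `z` up to a sign that passing to `-t` corrects.
  have hrange : range γ = {p ∈ fiber lam (h, c) | 0 < σ * p 1} := by
    refine Subset.antisymm (range_subset_iff.2 fun t => ⟨hfib t, hsign t⟩) ?_
    rintro p ⟨hp, hpσ⟩
    obtain ⟨hp1, hp0, -, hpW⟩ := apply_zero_sq hh hlam hp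
    have hv : 0 < p 1 ^ 2 := by positivity
    have hWv : potential lam h (p 1 ^ 2) ≤ 2 * c := by linarith [sq_nonneg (p 2)]
    have hlow : Y₁ ≤ p 1 ^ 2 := by
      by_contra! hcon
      have := potential_lt_max hlam hh hv hcon huT
      rw [hW₁, hWT, max_eq_right hWv] at this
      exact lt_irrefl _ this
    have hup : p 1 ^ 2 ≤ γ T 1 ^ 2 := by
      by_contra! hcon
      have := potential_lt_max hlam hh hY₁ huT hcon
      rw [hW₁, hWT, max_eq_left hWv] at this
      exact lt_irrefl _ this
    obtain ⟨t, -, ht⟩ := intermediate_value_Icc hT.le (hyc.pow 2).continuousOn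
      (show p 1 ^ 2 ∈ Icc (γ 0 1 ^ 2) (γ T 1 ^ 2) from ⟨by rwa [h01, hy2], hup⟩)
    have ht : γ t 1 ^ 2 = p 1 ^ 2 := ht
    have hy1 : γ t 1 = p 1 := by
      refine mul_left_cancel₀ hσ0 ((sq_eq_sq₀ (hsign t).le hpσ.le).1 ?_)
      rw [mul_pow, mul_pow, ht]
    have hx : γ t 0 = p 0 := by rw [(hfacts t).2.1, hp0, hy1]
    have hz : γ t 2 ^ 2 = p 2 ^ 2 := by
      have := (hfacts t).2.2.2
      rw [ht] at this
      linarith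
    rcases sq_eq_sq_iff_eq_or_eq_neg.1 hz with hz | hz
    · exact ⟨t, ext3 hx hy1 hz⟩
    · refine ⟨-t, ?_⟩
      rw [hrefl]
      exact ext3 hx hy1 (by simp [hz])
  refine ⟨⟨γ, T - -T, hT2, hγ, hper, hne, hrange⟩, ?_⟩
  rw [← hrange]
  exact exists_circle_param hcont hne hT2 hper fun s t hst => periodic_of_eq hlam hγ hst

/-! ### Principal fibers and the image -/

theorem mem_sigmaP {lam : ℕ} {q : ℝ × ℝ} (hq : q ∈ sigmaPPlus lam ∪ sigmaPMinus lam) :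
    q.1 ^ 2 < (lam : ℝ) ^ lam * (2 / ((lam : ℝ) + 1)) ^ (lam + 1) * q.2 ^ (lam + 1) ∧
      q.1 ≠ 0 ∧ 0 < q.2 := by
  rcases hq with ⟨h, h1, h2⟩ | ⟨h, h1, h2⟩
  · exact ⟨h, h1.ne', h2⟩
  · exact ⟨h, h1.ne, h2⟩

theorem fiber_eq_union_halves {lam : ℕ} (hlam : lam ≠ 0) {h c : ℝ} (hh : h ≠ 0) :
    fiber lam (h, c) = {p ∈ fiber lam (h, c) | 0 < (1 : ℝ) * p 1} ∪
      {p ∈ fiber lam (h, c) | 0 < (-1 : ℝ) * p 1} := by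
  ext p
  simp only [mem_union, mem_ofPred_eq, ← and_or_left, one_mul, neg_one_mul, Left.neg_pos_iff]
  exact ⟨fun hp => ⟨hp, (apply_zero_sq hh hlam hp).1.lt_or_gt.symm⟩, fun hp => hp.1⟩

theorem disjoint_halves (S : Set R3) :
    Disjoint {p ∈ S | 0 < (1 : ℝ) * p 1} {p ∈ S | 0 < (-1 : ℝ) * p 1} := by
  refine disjoint_left.2 fun p hp hp' => ?_
  have h1 := hp.2
  have h2 := hp'.2
  linarith

theorem nonempty_homeomorph_sum {X Y Z : Type*} [TopologicalSpace X] [TopologicalSpace Y]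
    [TopologicalSpace Z] [CompactSpace X] [CompactSpace Y] [T2Space Z] {f : X → Z} {g : Y → Z}
    (hf : Continuous f) (hg : Continuous g) (hfi : Function.Injective f)
    (hgi : Function.Injective g) (hd : Disjoint (range f) (range g)) {S : Set Z}
    (hS : S = range f ∪ range g) : Nonempty (S ≃ₜ X ⊕ Y) :=
  nonempty_range_homeomorph (hf.sumElim hg)
    (hfi.sumElim hgi fun a b h => disjoint_left.1 hd ⟨a, rfl⟩ ⟨b, h.symm⟩)
    (by rw [hS, Sum.elim_range])

theorem principal_fiber {lam : ℕ} (hlam : lam ≠ 0) {q : ℝ × ℝ}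
    (hq : q ∈ sigmaPPlus lam ∪ sigmaPMinus lam) :
    Nonempty (fiber lam q ≃ₜ Circle ⊕ Circle) ∧
      ∃ O₁ O₂ : Set R3, fiber lam q = O₁ ∪ O₂ ∧ Disjoint O₁ O₂ ∧
        Nonempty (O₁ ≃ₜ Circle) ∧ Nonempty (O₂ ≃ₜ Circle) ∧
        IsPeriodicOrbit (field lam) O₁ ∧ IsPeriodicOrbit (field lam) O₂ := by
  obtain ⟨h, c⟩ := q
  obtain ⟨hlt, hh, hc⟩ := mem_sigmaP hq
  obtain ⟨hper₁, f₁, hf₁, hi₁, hr₁⟩ :=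
    exists_periodic_half_fiber hlam hh hc hlt (σ := 1) (by norm_num)
  obtain ⟨hper₂, f₂, hf₂, hi₂, hr₂⟩ :=
    exists_periodic_half_fiber hlam hh hc hlt (σ := -1) (by norm_num)
  have hU := fiber_eq_union_halves hlam (c := c) hh
  have hD := disjoint_halves (fiber lam (h, c))
  refine ⟨nonempty_homeomorph_sum hf₁ hf₂ hi₁ hi₂ ?_ ?_, _, _, hU, hD,
    nonempty_range_homeomorph hf₁ hi₁ hr₁, nonempty_range_homeomorph hf₂ hi₂ hr₂, hper₁, hper₂⟩
  · rwa [hr₁, hr₂]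
  · rwa [hr₁, hr₂]

theorem range_EC {lam : ℕ} (hlam : lam ≠ 0) :
    range (EC lam) =
      (sigmaPPlus lam ∪ sigmaSPlus lam ∪ sigmaU lam ∪ sigmaSZero lam) ∪
      (sigmaPMinus lam ∪ sigmaSMinus lam ∪ sigmaU lam ∪ sigmaSZero lam) := by
  refine Subset.antisymm ?_ ?_
  · rintro _ ⟨p, rfl⟩
    obtain ⟨hle, heq⟩ := casimir_sq_le hlam p
    have hc : 0 ≤ (EC lam p).2 := by
      simp only [EC]
      positivity
    by_cases hh : (EC lam p).1 = 0
    · left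
      rcases hc.eq_or_lt with hc | hc
      · right
        rw [sigmaSZero_eq]
        exact Prod.ext hh hc.symm
      · left; right
        have := mem_sigmaU (lam := lam) hc
        rwa [← hh] at this
    · have hne0 : p 0 ≠ 0 := fun h0 => hh (by simp [EC, h0])
      have hc : 0 < (EC lam p).2 := by
        simp only [EC]
        positivity
      rcases hle.eq_or_lt with h | h
      · have hmem : EC lam p ∈ EC lam '' equilibriaSStar lam :=
          ⟨p, mem_equilibriaSStar.2 ⟨hne0, heq h⟩, rfl⟩
        rcases lt_or_gt_of_ne hh with hs | hs
        · exact Or.inr (Or.inl (Or.inl (Or.inr ⟨hmem, hs, hc⟩)))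
        · exact Or.inl (Or.inl (Or.inl (Or.inr ⟨hmem, hs, hc⟩)))
      · rcases lt_or_gt_of_ne hh with hs | hs
        · exact Or.inr (Or.inl (Or.inl (Or.inl ⟨h, hs, hc⟩)))
        · exact Or.inl (Or.inl (Or.inl (Or.inl ⟨h, hs, hc⟩)))
  -- The principal fibers contain a periodic orbit, hence are nonempty.
  · have hP : sigmaPPlus lam ∪ sigmaPMinus lam ⊆ range (EC lam) := by
      intro q hq
      obtain ⟨O₁, O₂, hO, -, -, -, ⟨γ, -, -, -, -, -, rfl⟩, -⟩ := (principal_fiber hlam hq).2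
      exact ⟨γ 0, (hO ▸ Or.inl ⟨0, rfl⟩ : γ 0 ∈ fiber lam q)⟩
    have hS : EC lam '' equilibriaSStar lam ⊆ range (EC lam) := image_subset_range _ _
    have hU : sigmaU lam ⊆ range (EC lam) := image_subset_range _ _
    have h0 : sigmaSZero lam ⊆ range (EC lam) := image_subset_range _ _
    exact union_subset
      (union_subset (union_subset (union_subset (subset_union_left.trans hP)
        (inter_subset_left.trans hS)) hU) h0)
      (union_subset (union_subset (union_subset (subset_union_right.trans hP)
        (inter_subset_left.trans hS)) hU) h0)

end Rattleback

end

theorem proposition6p1 (lam : ℕ) (hlam : 1 < lam) :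
    -- the strata exhaust the image, so that every nonempty fiber is described below
    (Set.range (Rattleback.EC lam) =
      (Rattleback.sigmaPPlus lam ∪ Rattleback.sigmaSPlus lam ∪ Rattleback.sigmaU lam ∪
        Rattleback.sigmaSZero lam) ∪
      (Rattleback.sigmaPMinus lam ∪ Rattleback.sigmaSMinus lam ∪ Rattleback.sigmaU lam ∪
        Rattleback.sigmaSZero lam)) ∧
    -- principal strata: two disjoint circles, which are periodic orbits
    (∀ q ∈ Rattleback.sigmaPPlus lam ∪ Rattleback.sigmaPMinus lam,
      Nonempty (Rattleback.fiber lam q ≃ₜ Circle ⊕ Circle) ∧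
      ∃ O₁ O₂ : Set Rattleback.R3,
        Rattleback.fiber lam q = O₁ ∪ O₂ ∧ Disjoint O₁ O₂ ∧
        Nonempty (O₁ ≃ₜ Circle) ∧ Nonempty (O₂ ≃ₜ Circle) ∧
        Rattleback.IsPeriodicOrbit (Rattleback.field lam) O₁ ∧
        Rattleback.IsPeriodicOrbit (Rattleback.field lam) O₂) ∧
    -- two stable equilibria
    (∀ q ∈ Rattleback.sigmaSPlus lam ∪ Rattleback.sigmaSMinus lam,
      ∃ a b : Rattleback.R3, a ≠ b ∧ Rattleback.fiber lam q = {a, b} ∧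
        Rattleback.IsStableEquilibrium (Rattleback.field lam) a ∧
        Rattleback.IsStableEquilibrium (Rattleback.field lam) b) ∧
    -- heteroclinic cycles
    (∀ q ∈ Rattleback.sigmaU lam, ∃ r : ℝ, 0 < r ∧ q = (0, r ^ 2 / 2) ∧
      Rattleback.fiber lam q = {p | p 0 * p 1 = 0} ∩ Metric.sphere 0 r ∧
      Rattleback.fiber lam q = (⋃ (s : ℤˣ) (t : ℤˣ), Rattleback.semicirclePair r s t) ∧
      Rattleback.IsUnstableEquilibrium (Rattleback.field lam) (Rattleback.e3 r) ∧
      Rattleback.IsUnstableEquilibrium (Rattleback.field lam) (Rattleback.e3 (-r)) ∧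
      (∀ s : ℤˣ, Rattleback.IsHeteroclinicOrbit (Rattleback.field lam)
        (Rattleback.e3 (-r)) (Rattleback.e3 r) (Rattleback.semicircleX r s)) ∧
      (∀ s : ℤˣ, Rattleback.IsHeteroclinicOrbit (Rattleback.field lam)
        (Rattleback.e3 r) (Rattleback.e3 (-r)) (Rattleback.semicircleY r s)) ∧
      (∀ s t : ℤˣ, Rattleback.IsHeteroclinicCycle (Rattleback.field lam)
        (Rattleback.semicirclePair r s t))) ∧
    -- the origin
    (∀ q ∈ Rattleback.sigmaSZero lam, q = (0, 0) ∧ Rattleback.fiber lam q = {0} ∧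
      Rattleback.IsStableEquilibrium (Rattleback.field lam) 0) := by
  have hlam0 : lam ≠ 0 := by omega
  refine ⟨Rattleback.range_EC hlam0, fun q hq => Rattleback.principal_fiber hlam0 hq,
    fun q hq => ?_, fun q hq => ?_, fun q hq => ?_⟩
  · obtain ⟨e, he, rfl⟩ := Rattleback.exists_of_mem_sigmaS hq
    exact ⟨e, Rattleback.flip lam e, Rattleback.flip_ne hlam0 he, Rattleback.fiber_eq_pair hlam0 he,
      Rattleback.isStableEquilibrium_of_mem_equilibriaSStar hlam0 he,
      Rattleback.isStableEquilibrium_of_mem_equilibriaSStar hlam0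
        (Rattleback.flip_mem_equilibriaSStar he)⟩
  · obtain ⟨r, hr, rfl⟩ := Rattleback.eq_of_mem_sigmaU hq
    have hX := Rattleback.isHeteroclinicOrbit_semicircleX lam hr
    have hY := Rattleback.isHeteroclinicOrbit_semicircleY hlam0 hr
    have hfib := Rattleback.fiber_zero_eq_inter_sphere hlam0 hr
    exact ⟨r, hr, rfl, hfib, hfib.trans (Rattleback.inter_sphere_eq_iUnion hr),
      (hY 1).isUnstableEquilibrium, (hX 1).isUnstableEquilibrium, hX, hY,
      Rattleback.isHeteroclinicCycle_semicirclePair hlam0 hr⟩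
  · rw [Rattleback.sigmaSZero_eq, Set.mem_singleton_iff] at hq
    subst hq
    exact ⟨rfl, Rattleback.fiber_zero_zero, Rattleback.isStableEquilibrium_zero hlam0⟩
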